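/- Let $K$ be a field, let $n, k \ge 0$ and $t \ge 1$ be integers, and suppose that $n = kt + l$ with $1 \le l \le t$. Let $R = K[x_1, \dots, x_n]$ and let $I_{n,t} \subseteq R$ be the $t$-path ideal of the path graph $P_n$ on $\{1, \dots, n\}$, that is, the ideal generated by the products $x_{i_1} \cdots x_{i_t}$ over all paths $i_1, \dots, i_t$ on $t$ distinct vertices of $P_n$. Let $I_{n,t}^{[k]}$ be its $k$-th squarefree power, that is, the ideal generated by the squarefree monomials among the minimal monomial generators of $I_{n,t}^k$ (with $I_{n,t}^{[0]} = I_{n,t}^0 = R$). Let $\Sigma_{n,t}^{[k]}$ be the Stanley–Reisner complex of $I_{n,t}^{[k]}$, whose faces are the sets $F \subseteq \{1, \dots, n\}$ with $\prod_{i \in F} x_i \notin I_{n,t}^{[k]}$, and let $$\Delta_{n,t}^{[k]} = \{ \{1, \dots, n\} \setminus F : F \subseteq \{1, \dots, n\},\ F \notin \Sigma_{n,t}^{[k]} \}$$ be its Alexander dual. (In particular $\Delta_{n,t}^{[0]}$ is the full simplex on $\{1, \dots, n\}$.) Then the geometric realization of $\Delta_{n,t}^{[k]}$ satisfies $$\Delta_{n,t}^{[k]}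 \simeq \bigvee_{\binom{k}{l}} S^{l-1},$$ that is, it is homotopy equivalent to the wedge of $\binom{k}{l}$ spheres of dimension $l - 1$; here the empty wedge is a point, so that for $k < l$ the complex $\Delta_{n,t}^{[k]}$ is contractible. -/

import Mathlib

namespace TYoung

noncomputable section

/-! ### Monomial ideals -/

section Ideals

variable (K : Type*) [Field K] {V : Type*}

/-- The squarefree monomial `x_F`, the product of the variables `x_v` with `v ∈ F`. -/
def squarefreeMonomial (F : Finset V) : MvPolynomial V K :=
  ∏ v ∈ F, MvPolynomial.X v

/-- The `t`-path ideal of a graph, generated by the products of the vertices of the paths on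
`t` vertices, that is, of the walks without repeated vertices whose list of vertices has
length `t`. -/
def pathIdeal [DecidableEq V] (G : SimpleGraph V) (t : ℕ) : Ideal (MvPolynomial V K) :=
  Ideal.span {m | ∃ (u v : V) (p : G.Walk u v),
    p.IsPath ∧ p.support.length = t ∧ m = squarefreeMonomial K p.support.toFinset}

variable {K}

/-- The exponents of the minimal monomial generators of a monomial ideal: the exponents of the
monomials in the ideal that are minimal with respect to divisibility. -/
def minimalExponents (I : Ideal (MvPolynomial V K)) : Set (V →₀ ℕ) :=
  {a | Minimal (fun b => MvPolynomial.monomial b (1 : K) ∈ I) a}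

/-- The `k`-th squarefree power of a monomial ideal `I`, generated by the squarefree minimal
monomial generators of `I ^ k`. -/
def squarefreePower (I : Ideal (MvPolynomial V K)) (k : ℕ) : Ideal (MvPolynomial V K) :=
  Ideal.span {m | ∃ a ∈ minimalExponents (I ^ k),
    (∀ v, a v ≤ 1) ∧ m = MvPolynomial.monomial a (1 : K)}

/-! ### Simplicial complexes

An abstract simplicial complex on `V` is a family of finite subsets of `V` that is closed under
taking subsets, that is, a `LowerSet (Finset V)`. The empty set is allowed as a face. -/

/-- The Stanley-Reisner complex of a squarefree monomial ideal `I`. Its faces are the sets `F`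
with `x_F ∉ I`, so that `I` is generated by the monomials of the non-faces. -/
def stanleyReisnerComplex (I : Ideal (MvPolynomial V K)) : LowerSet (Finset V) where
  carrier := {F | squarefreeMonomial K F ∉ I}
  lower' := fun _ _ hFG hG hF =>
    hG (I.mem_of_dvd (Finset.prod_dvd_prod_of_subset _ _ _ hFG) hF)

end Ideals

/-- The Alexander dual: its faces are the complements of the non-faces. -/
def alexanderDual {V : Type*} [Fintype V] [DecidableEq V] (Δ : LowerSet (Finset V)) :
    LowerSet (Finset V) where
  carrier := {F | ∃ G, G ∉ Δ ∧ F = Gᶜ}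
  lower' := by
    rintro _ F hF ⟨G, hG, rfl⟩
    refine ⟨Fᶜ, fun h => hG (Δ.lower ?_ h), (compl_compl F).symm⟩
    exact le_compl_comm.mp hF

/-- The geometric realization of a simplicial complex on a finite vertex set, as a subspace of
`V → ℝ`: the points of the standard simplex (barycentric coordinates) supported on a face. -/
def realization {V : Type*} [Fintype V] (Δ : LowerSet (Finset V)) : Set (V → ℝ) :=
  {x | x ∈ stdSimplex ℝ V ∧ ∃ F ∈ Δ, Function.support x ⊆ (F : Set V)}

/-- The complex `Δ_{n,t}^{[k]}`: the Alexander dual of the Stanley-Reisner complex of the `k`-th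
squarefree power of the `t`-path ideal of the path graph on `n` vertices. -/
def pathDualComplex (K : Type*) [Field K] (n t k : ℕ) : LowerSet (Finset (Fin n)) :=
  alexanderDual (stanleyReisnerComplex
    (squarefreePower (pathIdeal K (SimpleGraph.pathGraph n) t) k))

/-! ### Wedges of spheres -/

/-- The unit sphere `S^d` in `ℝ^(d+1)` with the Euclidean norm. -/
abbrev Sphere (d : ℕ) : Type :=
  Metric.sphere (0 : EuclideanSpace ℝ (Fin (d + 1))) 1

/-- The base point `(1, 0, …, 0)` of `S^d`. -/
def sphereBase (d : ℕ) : Sphere d :=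
  ⟨EuclideanSpace.single 0 1, by simp⟩

/-- The relation that glues all base points to one additional point. -/
inductive WedgeRel {ι : Type*} (X : ι → Type*) (x : ∀ i, X i) :
    Unit ⊕ (Σ i, X i) → Unit ⊕ (Σ i, X i) → Prop
  | glue (i : ι) : WedgeRel X x (Sum.inr ⟨i, x i⟩) (Sum.inl ())

/-- The wedge sum of a family of pointed spaces, with the quotient topology. Owing to the
additional base point, the wedge of the empty family is a point. -/
abbrev Wedge {ι : Type*} (X : ι → Type*) (x : ∀ i, X i) : Type _ :=
  Quot (WedgeRel X x)

/-- The wedge of `m` spheres of dimension `d`. -/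
abbrev WedgeOfSpheres (m d : ℕ) : Type :=
  Wedge (fun _ : Fin m => Sphere d) (fun _ => sphereBase d)

end

end TYoung

namespace TYoung

open Topology unitInterval

noncomputable section

/-! Number the vertices from 0. The complement of a face contains `k` disjoint `t`-paths; they are
intervals and leave exactly `l` vertices free. A free vertex with `i` free vertices below it has a
multiple of `t` covered vertices below it, so its residue mod `t` is `i`. Hence the faces are the
sets whose residues mod `t` are less than `l` and strictly increasing (`mem_pathDualComplex_iff`),
and the facets are the sets of all `t * q i + i`, `i < l`, with `0 ≤ q 0 ≤ q 1 ≤ ⋯ ≤ k`.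

An initial chain of length `j` consists of such vertices for `i < j` with `0 < q 0 < q 1 < ⋯`. Let
`D j` be the subcomplex of faces containing no initial chain of length `j`. `D 1` is a cone with
apex 0. A chain of length `j + 1` contains one of length `j`, so `D j` arises from `D (j + 1)` by
removing the faces through chains `τ` of length `j`. The link of `τ` in `D (j + 1)` is a cone whose
apex is the successor of the last vertex of `τ`, and pushing mass from `τ` to the apex is a
deformation retraction (`contractibleSpace_realization_of_deletion_singleton`). By induction `D l`
is contractible.

The faces outside `D l` are exactly the initial chains of length `l`: facets with `l` vertices,
`k.choose l` in number (`card_initialChains`). So the complex is a contractible space with that many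
`(l - 1)`-cells attached, and collapsing `D l` gives the wedge (`homotopyEquiv_wedge_of_cells`). -/

/-! ### The quotient map from a ball to a sphere -/

/-- The closed unit ball of `ℝ^d`. -/
abbrev Ball (d : ℕ) : Type :=
  Metric.closedBall (0 : EuclideanSpace ℝ (Fin d)) 1

lemma Ball.norm_le {d : ℕ} (y : Ball d) : ‖y.1‖ ≤ 1 :=
  mem_closedBall_zero_iff.1 y.2

lemma Ball.norm_sq_le {d : ℕ} (y : Ball d) : ‖y.1‖ ^ 2 ≤ 1 :=
  pow_le_one₀ (norm_nonneg _) y.norm_le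

lemma norm_sq_toLp_cons {d : ℕ} (a b : ℝ) (y : EuclideanSpace ℝ (Fin d)) :
    ‖(WithLp.toLp 2 (Fin.cons a (fun i => b * y i)) : EuclideanSpace ℝ (Fin (d + 1)))‖ ^ 2 =
      a ^ 2 + b ^ 2 * ‖y‖ ^ 2 := by
  rw [EuclideanSpace.norm_sq_eq, EuclideanSpace.norm_sq_eq, Fin.sum_univ_succ]
  simp [mul_pow, Finset.mul_sum]

/-- The map from the ball `B^d` to the sphere `S^d` that collapses the boundary of the ball to
the base point. -/
def ballToSphere (d : ℕ) : C(Ball d, Sphere d) where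
  -- Double-angle formula: for `‖y‖ = cos θ` and `y ≠ 0` the image is `(cos 2θ, sin 2θ · y / ‖y‖)`.
  toFun y := ⟨WithLp.toLp 2 (Fin.cons (2 * ‖y.1‖ ^ 2 - 1)
      (fun i => (2 * √(1 - ‖y.1‖ ^ 2)) * y.1 i)), by
    have h := Real.sq_sqrt (sub_nonneg.2 y.norm_sq_le)
    rw [mem_sphere_zero_iff_norm, ← sq_eq_sq₀ (norm_nonneg _) zero_le_one, norm_sq_toLp_cons,
      mul_pow, h]
    ring⟩
  continuous_toFun := by
    refine Continuous.subtype_mk ((PiLp.continuous_toLp 2 _).comp ?_) _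
    refine continuous_pi fun i => ?_
    induction i using Fin.cases with
    | zero => simp only [Fin.cons_zero]; fun_prop
    | succ i => simp only [Fin.cons_succ]; fun_prop

lemma ballToSphere_zero {d : ℕ} (y : Ball d) :
    (ballToSphere d y).1 0 = 2 * ‖y.1‖ ^ 2 - 1 := rfl

lemma ballToSphere_succ {d : ℕ} (y : Ball d) (i : Fin d) :
    (ballToSphere d y).1 i.succ = (2 * √(1 - ‖y.1‖ ^ 2)) * y.1 i := rfl

lemma sphere_norm_sq {d : ℕ} (s : Sphere d) : s.1 0 ^ 2 + ∑ i : Fin d, s.1 i.succ ^ 2 = 1 := by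
  have h : ‖s.1‖ = 1 := by simp
  have h2 := EuclideanSpace.norm_sq_eq s.1
  rw [h, Fin.sum_univ_succ] at h2
  simpa using h2.symm

lemma eq_sphereBase_iff {d : ℕ} (s : Sphere d) : s = sphereBase d ↔ s.1 0 = 1 := by
  constructor
  · rintro rfl
    simp [sphereBase]
  · intro h
    have h2 := sphere_norm_sq s
    rw [h, one_pow, add_eq_left, Finset.sum_eq_zero_iff_of_nonneg (fun _ _ => sq_nonneg _)] at h2
    ext i
    induction i using Fin.cases with
    | zero => simpa [sphereBase] using h
    | succ i => simpa [sphereBase] using h2 i (Finset.mem_univ i)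

lemma ballToSphere_eq_base_iff {d : ℕ} (y : Ball d) :
    ballToSphere d y = sphereBase d ↔ ‖y.1‖ = 1 := by
  rw [eq_sphereBase_iff, ballToSphere_zero, ← sq_eq_sq₀ (norm_nonneg _) zero_le_one]
  constructor <;> intro h <;> linarith

lemma eq_of_ballToSphere_eq {d : ℕ} {y z : Ball d} (h : ballToSphere d y = ballToSphere d z)
    (hy : ‖y.1‖ ≠ 1) : y = z := by
  have h0 := congrArg (fun s : Sphere d => s.1 0) h
  simp only [ballToSphere_zero] at h0
  have h1 : ‖y.1‖ ^ 2 = ‖z.1‖ ^ 2 := by linarith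
  have h2 : 0 < 1 - ‖y.1‖ ^ 2 := by
    have := lt_of_le_of_ne y.norm_le hy
    have h3 : ‖y.1‖ ^ 2 < 1 := pow_lt_one₀ (norm_nonneg _) this two_ne_zero
    linarith
  have h3 : 2 * √(1 - ‖y.1‖ ^ 2) ≠ 0 := by positivity
  ext i
  have h4 := congrArg (fun s : Sphere d => s.1 i.succ) h
  simp only [ballToSphere_succ, ← h1] at h4
  exact mul_left_cancel₀ h3 h4

lemma exists_ballToSphere_eq {d : ℕ} (s : Sphere d) (hs : s ≠ sphereBase d) :
    ∃ y, ballToSphere d y = s := by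
  have hn := sphere_norm_sq s
  have hnn : 0 ≤ ∑ i : Fin d, s.1 i.succ ^ 2 := Finset.sum_nonneg fun _ _ => sq_nonneg _
  have h0 : s.1 0 < 1 := by
    refine lt_of_le_of_ne ?_ (fun h => hs ((eq_sphereBase_iff s).2 h))
    nlinarith
  -- Solving `2‖y‖² - 1 = s 0` gives `‖y‖² = (1 + s 0) / 2`, so `r` below is `√(1 - ‖y‖²)`.
  have hpos : 0 < 1 - (1 + s.1 0) / 2 := by linarith
  set r := √(1 - (1 + s.1 0) / 2) with hr
  have hr0 : 0 < r := Real.sqrt_pos.2 hpos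
  have hr2 : r ^ 2 = 1 - (1 + s.1 0) / 2 := Real.sq_sqrt hpos.le
  let y : EuclideanSpace ℝ (Fin d) := WithLp.toLp 2 (fun i => s.1 i.succ / (2 * r))
  have hy : ‖y‖ ^ 2 = (1 + s.1 0) / 2 := by
    rw [EuclideanSpace.norm_sq_eq]
    simp only [y, Real.norm_eq_abs, sq_abs, div_pow]
    rw [← Finset.sum_div, div_eq_iff (by positivity), mul_pow, hr2]
    linarith
  have hy1 : ‖y‖ ≤ 1 := by
    rw [← sq_le_sq₀ (norm_nonneg _) zero_le_one, hy]
    linarith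
  refine ⟨⟨y, by simpa using hy1⟩, ?_⟩
  ext i
  induction i using Fin.cases with
  | zero => rw [ballToSphere_zero, hy]; ring
  | succ i =>
    rw [ballToSphere_succ, hy, ← hr]
    simp only [y]
    field_simp

/-- The extra point is needed for `d = 0`, where the ball has no boundary and its image misses the
base point. -/
lemma isQuotientMap_ballToSphere (d : ℕ) :
    IsQuotientMap (Sum.elim (fun _ : Unit => sphereBase d) (ballToSphere d)) := by
  have hc : Continuous (Sum.elim (fun _ : Unit => sphereBase d) (ballToSphere d)) :=
    continuous_sum_dom.2 ⟨continuous_const, (ballToSphere d).continuous⟩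
  refine hc.isClosedMap.isQuotientMap hc fun s => ?_
  by_cases hs : s = sphereBase d
  · exact ⟨Sum.inl (), hs.symm⟩
  · obtain ⟨y, hy⟩ := exists_ballToSphere_eq s hs
    exact ⟨Sum.inr y, hy⟩

/-! ### Collapsing a contractible subspace -/

/-- If the contraction of a subspace `A` of `X` extends to a homotopy of the identity of `X`,
then the quotient map that collapses `A` to a point is a homotopy equivalence. -/
theorem homotopyEquiv_of_collapse {X W A : Type*} [TopologicalSpace X] [TopologicalSpace W]
    (i : A → X) (H : C(X × I, X)) (h0 : ∀ x, H (x, 0) = x)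
    (hA : ∀ a t, H (i a, t) ∈ Set.range i) (p : A) (h1 : ∀ a, H (i a, 1) = i p)
    (f : C(X, W)) (hf : IsQuotientMap f) (hfi : ∀ a b, f (i a) = f (i b))
    (hinj : ∀ x y, f x = f y → x = y ∨ x ∈ Set.range i ∧ y ∈ Set.range i) :
    Nonempty (ContinuousMap.HomotopyEquiv X W) := by
  have key : ∀ x y, f x = f y → ∀ t, f (H (x, t)) = f (H (y, t)) := by
    intro x y hxy t
    rcases hinj x y hxy with rfl | ⟨⟨a, rfl⟩, ⟨b, rfl⟩⟩
    · rfl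
    · obtain ⟨a', ha⟩ := hA a t
      obtain ⟨b', hb⟩ := hA b t
      rw [← ha, ← hb, hfi]
  -- At time 1 the subspace is a single point, so `H (·, 1)` factors through `f`; the factor `g` is
  -- the homotopy inverse.
  have key1 : ∀ x y, f x = f y → H (x, 1) = H (y, 1) := by
    intro x y hxy
    rcases hinj x y hxy with rfl | ⟨⟨a, rfl⟩, ⟨b, rfl⟩⟩
    · rfl
    · rw [h1, h1]
  let H1 : C(X, X) := ⟨fun x => H (x, 1), by fun_prop⟩
  let g : C(W, X) := hf.lift H1 key1
  have hg : ∀ x, g (f x) = H (x, 1) := fun x => DFunLike.congr_fun (hf.lift_comp H1 key1) x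
  -- The homotopy keeps `A` inside itself and `f` collapses `A`, so `f ∘ H` descends to `W × I`; the
  -- descended map joins the identity to `f ∘ g`.
  let G : W × I → W := fun p => f (H (Function.surjInv hf.surjective p.1, p.2))
  have hG : ∀ x t, G (f x, t) = f (H (x, t)) := fun x t =>
    key _ _ (Function.surjInv_eq hf.surjective (f x)) t
  have hGc : Continuous G := hf.continuous_lift_prod_left (by
    simp only [hG]
    exact (f.comp H).continuous)
  refine ⟨⟨f, g, ?_, ?_⟩⟩
  · refine ContinuousMap.Homotopic.symm ⟨⟨⟨fun p => H (p.2, p.1), by fun_prop⟩, ?_, ?_⟩⟩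
    · intro x; exact h0 x
    · intro x; exact (hg x).symm
  · refine ContinuousMap.Homotopic.symm ⟨⟨⟨fun p => G (p.2, p.1), by fun_prop⟩, ?_, ?_⟩⟩
    · intro w
      obtain ⟨x, rfl⟩ := hf.surjective w
      exact (hG x 0).trans (congrArg f (h0 x))
    · intro w
      obtain ⟨x, rfl⟩ := hf.surjective w
      exact (hG x 1).trans (congrArg f (hg x).symm)

/-! ### Attaching cells to a contractible space -/

/-- The nearest point of the closed unit ball. -/
def toBall {d : ℕ} (z : EuclideanSpace ℝ (Fin d)) : Ball d :=
  ⟨(max 1 ‖z‖)⁻¹ • z, by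
    have h : 0 < max 1 ‖z‖ := lt_max_of_lt_left one_pos
    rw [mem_closedBall_zero_iff, norm_smul, norm_inv, Real.norm_of_nonneg h.le, inv_mul_le_one₀ h]
    exact le_max_right _ _⟩

lemma continuous_toBall {d : ℕ} : Continuous (toBall (d := d)) := by
  refine Continuous.subtype_mk (Continuous.smul (Continuous.inv₀
    (continuous_const.max continuous_norm) fun z => ?_)
    continuous_id) _
  exact (lt_max_of_lt_left one_pos).ne'

lemma toBall_of_norm_le {d : ℕ} {z : EuclideanSpace ℝ (Fin d)} (hz : ‖z‖ ≤ 1) :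
    (toBall z).1 = z := by
  simp [toBall, max_eq_left hz]

/-- A homotopy of the boundary of a cell extends to a homotopy of the whole cell. -/
theorem exists_cell_homotopy {X A : Type*} [TopologicalSpace X] [TopologicalSpace A] {d : ℕ}
    (i : A → X) (hi : IsEmbedding i) (h : C(A × I, A)) (h0 : ∀ a, h (a, 0) = a)
    (φ : C(Ball d, X)) (hφ : ∀ y, ‖y.1‖ = 1 → φ y ∈ Set.range i) :
    ∃ F : C(Ball d × I, X), (∀ y, F (y, 0) = φ y) ∧
      ∀ y t a, ‖y.1‖ = 1 → φ y = i a → F (y, t) = i (h (a, t)) := by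
  classical
  rcases isEmpty_or_nonempty A with hA | hA
  · refine ⟨⟨fun p => φ p.1, by fun_prop⟩, fun _ => rfl, fun _ _ a => hA.elim a⟩
  let nrm : EuclideanSpace ℝ (Fin d) → EuclideanSpace ℝ (Fin d) := fun z => ‖z‖⁻¹ • z
  have nrm_norm : ∀ z, z ≠ 0 → ‖nrm z‖ = 1 := fun z hz => by
    simp [nrm, norm_smul, hz]
  -- Radial projection to the boundary sphere, read as a point of `A`; it is meaningful only away
  -- from the centre.
  let b : EuclideanSpace ℝ (Fin d) → A := fun z => Function.invFun i (φ (toBall (nrm z)))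
  have hb : ∀ z, z ≠ 0 → i (b z) = φ (toBall (nrm z)) := fun z hz =>
    Function.invFun_eq (hφ _ (by rw [toBall_of_norm_le (nrm_norm z hz).le, nrm_norm z hz]))
  have hbc : ContinuousOn b {0}ᶜ := by
    rw [hi.isInducing.continuousOn_iff]
    refine ContinuousOn.congr (f := fun z => φ (toBall (nrm z))) ?_ fun z hz => hb z hz
    refine (φ.continuous.comp continuous_toBall).comp_continuousOn ?_
    refine ContinuousOn.smul (ContinuousOn.inv₀ continuous_norm.continuousOn ?_) continuousOn_id
    intro z hz
    simpa using hz
  -- At time `t` the cell is stretched by `1 + t`. Points still inside the ball follow `φ`; a point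
  -- pushed out to radius `1 + u` follows the given homotopy of its boundary point up to time `u`. A
  -- boundary point has `u = t`.
  let s : Set (EuclideanSpace ℝ (Fin d) × I) := {p | (1 + p.2.1) * ‖p.1‖ ≤ 1}
  let s' : Set (EuclideanSpace ℝ (Fin d) × I) := {p | 1 ≤ (1 + p.2.1) * ‖p.1‖}
  let F1 : EuclideanSpace ℝ (Fin d) × I → X := fun p => φ (toBall ((1 + p.2.1) • p.1))
  let F2 : EuclideanSpace ℝ (Fin d) × I → X := fun p =>
    i (h (b p.1, Set.projIcc 0 1 zero_le_one ((1 + p.2.1) * ‖p.1‖ - 1)))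
  let F : EuclideanSpace ℝ (Fin d) × I → X := fun p => if p ∈ s then F1 p else F2 p
  have hF1c : Continuous F1 := φ.continuous.comp (continuous_toBall.comp (by fun_prop))
  have hne : ∀ p ∈ s', p.1 ≠ 0 := by
    intro p hp h0
    simp only [s', Set.mem_ofPred_eq, h0, norm_zero, mul_zero] at hp
    linarith
  have hF2c : ContinuousOn F2 s' := by
    refine (hi.continuous.comp h.continuous).comp_continuousOn (ContinuousOn.prodMk ?_ ?_)
    · exact hbc.comp continuousOn_fst fun p hp => hne p hp
    · exact (continuous_projIcc.comp (by fun_prop)).continuousOn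
  have h12 : ∀ p ∈ s, p ∈ s' → F1 p = F2 p := by
    intro p hp hp'
    have he : (1 + p.2.1) * ‖p.1‖ = 1 := le_antisymm hp hp'
    have hn : 1 + p.2.1 = ‖p.1‖⁻¹ := eq_inv_of_mul_eq_one_left he
    simp only [F1, F2, he, sub_self, Set.projIcc_left]
    have : (⟨0, Set.left_mem_Icc.2 zero_le_one⟩ : I) = 0 := rfl
    rw [this, h0, hb _ (hne p hp'), hn]
  have hFs' : ∀ p ∈ s', F p = F2 p := by
    intro p hp
    by_cases hps : p ∈ s
    · simp only [F, if_pos hps, h12 p hps hp]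
    · simp only [F, if_neg hps]
  have hs : IsClosed s := isClosed_le (by fun_prop) (by fun_prop)
  have hs' : IsClosed s' := isClosed_le (by fun_prop) (by fun_prop)
  have hFc : Continuous F := by
    rw [← continuousOn_univ]
    have hu : (Set.univ : Set (EuclideanSpace ℝ (Fin d) × I)) = s ∪ s' :=
      by
      ext p
      simpa [s, s'] using le_total ((1 + p.2.1) * ‖p.1‖) 1
    rw [hu]
    refine ContinuousOn.union_of_isClosed ?_ (hF2c.congr hFs') hs hs'
    exact hF1c.continuousOn.congr fun p hp => by simp only [F, if_pos hp]
  have hv : ∀ y : Ball d, toBall y.1 = y := fun y => Subtype.ext (toBall_of_norm_le y.norm_le)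
  refine ⟨⟨fun p => F (p.1.1, p.2), by fun_prop⟩, fun y => ?_, fun y t a hy ha => ?_⟩
  · have hm : ((y.1, 0) : EuclideanSpace ℝ (Fin d) × I) ∈ s := by
      simpa [s] using y.norm_le
    simp [F, if_pos hm, F1, hv]
  · have hm : ((y.1, t) : EuclideanSpace ℝ (Fin d) × I) ∈ s' := by
      have := t.2.1
      simp only [s', Set.mem_ofPred_eq, hy]
      linarith
    have hy0 : y.1 ≠ 0 := fun h => by simp [h] at hy
    have hba : b y.1 = a := by
      apply hi.injective
      rw [hb _ hy0, ← ha]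
      simp [nrm, hy, hv]
    simp only [ContinuousMap.coe_mk, hFs' _ hm, F2, hy, hba, mul_one, add_sub_cancel_left]
    rw [Set.projIcc_of_mem zero_le_one t.2]

/-- A space obtained from a contractible compact space by attaching finitely many cells of
dimension `d` is homotopy equivalent to a wedge of spheres. -/
theorem homotopyEquiv_wedge_of_cells {X A ι : Type*} [TopologicalSpace X] [T2Space X]
    [TopologicalSpace A] [CompactSpace A] [ContractibleSpace A] [Finite ι] {d : ℕ}
    (i : A → X) (hic : Continuous i) (hi : Function.Injective i) (φ : ι → C(Ball d, X))
    (hcov : ∀ x, x ∈ Set.range i ∨ ∃ j y, φ j y = x)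
    (hbd : ∀ j y, φ j y ∈ Set.range i ↔ ‖y.1‖ = 1)
    (hinj : ∀ j y j' y', φ j y = φ j' y' → φ j y ∉ Set.range i →
      (⟨j, y⟩ : Σ _ : ι, Ball d) = ⟨j', y'⟩) :
    Nonempty (ContinuousMap.HomotopyEquiv X
      (Wedge (fun _ : ι => Sphere d) (fun _ => sphereBase d))) := by
  have hemb : IsEmbedding i := (hic.isClosedEmbedding hi).isEmbedding
  obtain ⟨p, ⟨h⟩⟩ := id_nullhomotopic A
  let π : A ⊕ (Σ _ : ι, Ball d) → X := Sum.elim i fun q => φ q.1 q.2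
  have hπc : Continuous π :=
    continuous_sum_dom.2 ⟨hic, continuous_sigma fun j => (φ j).continuous⟩
  have hπ : IsQuotientMap π := by
    refine hπc.isClosedMap.isQuotientMap hπc fun x => ?_
    rcases hcov x with ⟨a, ha⟩ | ⟨j, y, hy⟩
    · exact ⟨Sum.inl a, ha⟩
    · exact ⟨Sum.inr ⟨j, y⟩, hy⟩
  -- two points with the same image are equal or are both mapped into `A`
  have hker : ∀ u v, π u = π v → u = v ∨ ∃ a, π u = i a ∧ π v = i a := by
    intro u v huv
    by_cases hr : π u ∈ Set.range i
    · obtain ⟨a, ha⟩ := hr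
      exact Or.inr ⟨a, ha.symm, huv.symm.trans ha.symm⟩
    · left
      rcases u with a | ⟨j, y⟩
      · exact absurd ⟨a, rfl⟩ hr
      · rcases v with a | ⟨j', y'⟩
        · exact absurd ⟨a, huv.symm⟩ hr
        · exact congrArg Sum.inr (hinj j y j' y' huv hr)
  -- the homotopy
  let hh : C(A × I, A) := ⟨fun q => h (q.2, q.1), by fun_prop⟩
  have hh0 : ∀ a, hh (a, 0) = a := fun a => h.apply_zero a
  choose F hF0 hF using fun j => exists_cell_homotopy i hemb hh hh0 (φ j)
    fun y hy => (hbd j y).2 hy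
  let iC : C(A, X) := ⟨i, hic⟩
  -- Written as a map into the path space, the homotopy descends along `π` itself rather than along
  -- `π × id`.
  let P : C(A ⊕ (Σ _ : ι, Ball d), C(I, X)) :=
    ⟨Sum.elim (iC.comp hh).curry fun q => (F q.1).curry q.2,
      continuous_sum_dom.2 ⟨(iC.comp hh).curry.continuous,
        continuous_sigma fun j => (F j).curry.continuous⟩⟩
  have hPA : ∀ u a, π u = i a → ∀ t, P u t = i (hh (a, t)) := by
    rintro (a' | ⟨j, y⟩) a hu t
    · rw [← hi hu]; rfl
    · exact hF j y t a ((hbd j y).1 ⟨a, hu.symm⟩) hu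
  have hP : ∀ u v, π u = π v → P u = P v := by
    intro u v huv
    rcases hker u v huv with rfl | ⟨a, hu, hv⟩
    · rfl
    · ext t
      rw [hPA u a hu, hPA v a hv]
  let πC : C(A ⊕ (Σ _ : ι, Ball d), X) := ⟨π, hπc⟩
  have hπ' : IsQuotientMap πC := hπ
  let Q : C(X, C(I, X)) := hπ'.lift P hP
  have hQ : ∀ u, Q (π u) = P u := fun u => DFunLike.congr_fun (hπ'.lift_comp P hP) u
  let H : C(X × I, X) := Q.uncurry
  have hHA : ∀ a t, H (i a, t) = i (hh (a, t)) := fun a t => by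
    change Q (π (Sum.inl a)) t = _
    rw [hQ]; rfl
  -- the map to the wedge
  let W := Wedge (fun _ : ι => Sphere d) (fun _ => sphereBase d)
  let base : W := Quot.mk _ (Sum.inl ())
  let inc : ι → Sphere d → W := fun j s => Quot.mk _ (Sum.inr ⟨j, s⟩)
  have hincb : ∀ j, inc j (sphereBase d) = base := fun j => Quot.sound (WedgeRel.glue j)
  have hincc : ∀ j, Continuous (inc j) := fun j =>
    continuous_quot_mk.comp (continuous_inr.comp continuous_sigmaMk)
  let f' : C(A ⊕ (Σ _ : ι, Ball d), W) := ⟨Sum.elim (fun _ => base)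
      fun q => inc q.1 (ballToSphere d q.2),
    continuous_sum_dom.2 ⟨continuous_const, continuous_sigma fun j =>
      (hincc j).comp (ballToSphere d).continuous⟩⟩
  have hf'A : ∀ u a, π u = i a → f' u = base := by
    rintro (a' | ⟨j, y⟩) a hu
    · rfl
    · change inc j (ballToSphere d y) = base
      rw [(ballToSphere_eq_base_iff y).2 ((hbd j y).1 ⟨a, hu.symm⟩), hincb]
  have hf' : ∀ u v, πC u = πC v → f' u = f' v := by
    intro u v huv
    rcases hker u v huv with rfl | ⟨a, hu, hv⟩
    · rfl
    · rw [hf'A u a hu, hf'A v a hv]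
  let f : C(X, W) := hπ'.lift f' hf'
  have hf : ∀ u, f (π u) = f' u := fun u => DFunLike.congr_fun (hπ'.lift_comp f' hf') u
  -- an invariant that separates the points of the wedge
  classical
  let sep : W → Option (Σ _ : ι, Sphere d) := Quot.lift
    (Sum.elim (fun _ => none) fun q => if q.2 = sphereBase d then none else some q) (by
      rintro _ _ ⟨j⟩
      simp)
  have hsep : ∀ j s, s ≠ sphereBase d → sep (inc j s) = some ⟨j, s⟩ := fun j s hs => if_neg hs
  have hsepA : ∀ j y, φ j y ∉ Set.range i → sep (f' (Sum.inr ⟨j, y⟩)) =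
      some ⟨j, ballToSphere d y⟩ := fun j y hy =>
    hsep _ _ fun h => hy ((hbd j y).2 ((ballToSphere_eq_base_iff y).1 h))
  -- Openness is tested on each sphere, and there on the ball covering it, so the wedge need not be
  -- known to be Hausdorff.
  have hfq : IsQuotientMap f := by
    rw [isQuotientMap_iff, isCoinducing_iff, and_comm]
    refine ⟨?_, fun U => ⟨fun hU => ?_, fun hU => hU.preimage f.continuous⟩⟩
    · have hb : ∃ x, f x = base := ⟨i p, hf (Sum.inl p)⟩
      rintro ⟨⟨⟩ | ⟨j, s⟩⟩
      · exact hb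
      · by_cases hs : s = sphereBase d
        · subst hs
          obtain ⟨x, hx⟩ := hb
          exact ⟨x, hx.trans (hincb j).symm⟩
        · obtain ⟨y, rfl⟩ := exists_ballToSphere_eq s hs
          exact ⟨φ j y, hf (Sum.inr ⟨j, y⟩)⟩
    · rw [← (isQuotientMap_quot_mk).isOpen_preimage, isOpen_sum_iff]
      refine ⟨isOpen_discrete _, isOpen_sigma_iff.2 fun j => ?_⟩
      rw [← (isQuotientMap_ballToSphere d).isOpen_preimage, isOpen_sum_iff]
      refine ⟨isOpen_discrete _, ?_⟩
      convert hU.preimage (φ j).continuous using 1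
      ext y
      change f' (Sum.inr ⟨j, y⟩) ∈ U ↔ f (π (Sum.inr ⟨j, y⟩)) ∈ U
      rw [hf]
  refine homotopyEquiv_of_collapse i H ?_ (fun a t => ⟨_, (hHA a t).symm⟩) p ?_ f hfq ?_ ?_
  · intro x
    obtain ⟨u, rfl⟩ := hπ.surjective x
    change Q (π u) 0 = π u
    rw [hQ]
    rcases u with a | ⟨j, y⟩
    · exact congrArg i (hh0 a)
    · exact hF0 j y
  · intro a
    rw [hHA]
    exact congrArg i (h.apply_one a)
  · intro a b
    exact (hf (Sum.inl a)).trans (hf (Sum.inl b)).symm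
  · intro x y hxy
    obtain ⟨u, rfl⟩ := hπ.surjective x
    obtain ⟨v, rfl⟩ := hπ.surjective y
    rw [hf, hf] at hxy
    have hnone : ∀ u, π u ∈ Set.range i → sep (f' u) = none := by
      rintro u ⟨a, ha⟩
      rw [hf'A u a ha.symm]
      rfl
    by_cases hu : π u ∈ Set.range i
    · by_cases hv : π v ∈ Set.range i
      · exact Or.inr ⟨hu, hv⟩
      · exfalso
        rcases v with a | ⟨j, y⟩
        · exact hv ⟨a, rfl⟩
        · have := hsepA j y hv
          rw [← hxy, hnone u hu] at this
          cases this
    · left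
      rcases u with a | ⟨j, y⟩
      · exact absurd ⟨a, rfl⟩ hu
      have h1 := hsepA j y hu
      by_cases hv : π v ∈ Set.range i
      · rw [hxy, hnone v hv] at h1
        cases h1
      · rcases v with a | ⟨j', y'⟩
        · exact absurd ⟨a, rfl⟩ hv
        have h2 := hsepA j' y' hv
        rw [hxy, h2] at h1
        obtain ⟨rfl, h3⟩ := Sigma.mk.inj (Option.some.inj h1)
        rw [eq_of_ballToSphere_eq (eq_of_heq h3).symm fun hy => hu ((hbd _ y).2 hy)]

/-! ### Homotopies of geometric realizations -/

section Realization

variable {V : Type*} [Fintype V] [DecidableEq V]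

lemma mem_realization_iff (Δ : LowerSet (Finset V)) (x : V → ℝ) :
    x ∈ realization Δ ↔ x ∈ stdSimplex ℝ V ∧ Finset.univ.filter (fun v => x v ≠ 0) ∈ Δ := by
  refine and_congr_right fun _ => ⟨?_, fun h => ⟨_, h, fun v hv => by simpa using hv⟩⟩
  rintro ⟨F, hF, hx⟩
  refine Δ.lower ?_ hF
  intro v hv
  exact hx (Finset.mem_filter.1 hv).2

lemma realization_mono {Δ Δ' : LowerSet (Finset V)} (h : Δ' ≤ Δ) :
    realization Δ' ⊆ realization Δ :=
  fun _ ⟨hx, F, hF, hxF⟩ => ⟨hx, F, h hF, hxF⟩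

lemma segment_subset_realization {Δ : LowerSet (Finset V)} {F : Finset V} (hF : F ∈ Δ)
    {x y : V → ℝ} (hx : x ∈ stdSimplex ℝ V) (hy : y ∈ stdSimplex ℝ V)
    (hxF : Function.support x ⊆ F) (hyF : Function.support y ⊆ F) :
    segment ℝ x y ⊆ realization Δ := by
  intro z hz
  refine ⟨(convex_stdSimplex ℝ V).segment_subset hx hy hz, F, hF, ?_⟩
  obtain ⟨a, b, -, -, -, rfl⟩ := hz
  intro v hv
  by_contra hvF
  have h1 : x v = 0 := by_contra fun h => hvF (hxF h)
  have h2 : y v = 0 := by_contra fun h => hvF (hyF h)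
  simp [h1, h2] at hv

/-- Two maps into a subset of a real vector space that are joined by segments in the subset are
homotopic. -/
lemma homotopic_of_segment_subset {Y E : Type*} [TopologicalSpace Y] [AddCommGroup E]
    [Module ℝ E] [TopologicalSpace E] [ContinuousAdd E] [ContinuousSMul ℝ E] {S : Set E}
    (f g : C(Y, S)) (h : ∀ y, segment ℝ (f y).1 (g y).1 ⊆ S) : f.Homotopic g := by
  refine ⟨⟨⟨fun p => ⟨(1 - p.1.1) • (f p.2).1 + p.1.1 • (g p.2).1,
    h p.2 ⟨1 - p.1.1, p.1.1, sub_nonneg.2 p.1.2.2, p.1.2.1, by ring, rfl⟩⟩, ?_⟩, ?_, ?_⟩⟩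
  · fun_prop
  · intro y
    ext
    simp
  · intro y
    ext
    simp

/-- A cone is contractible. -/
theorem contractibleSpace_realization_of_cone {Δ : LowerSet (Finset V)} (w : V) (h0 : ∅ ∈ Δ)
    (h : ∀ F ∈ Δ, insert w F ∈ Δ) : ContractibleSpace (realization Δ) := by
  rw [contractible_iff_id_nullhomotopic]
  have hw : Pi.single w 1 ∈ stdSimplex ℝ V := single_mem_stdSimplex ℝ w
  have hsupp : Function.support (Pi.single w 1 : V → ℝ) ⊆ {w} := Pi.support_single_subset
  refine ⟨⟨Pi.single w 1, hw, {w}, by simpa using h _ h0, by simp⟩, ?_⟩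
  refine homotopic_of_segment_subset _ _ fun x => ?_
  obtain ⟨hx, F, hF, hxF⟩ := x.2
  refine segment_subset_realization (h F hF) hx hw (fun v hv => ?_) fun v hv => ?_
  · exact Finset.mem_coe.2 (Finset.mem_insert_of_mem (hxF hv))
  · rw [Set.mem_singleton_iff.1 (hsupp hv)]
    simp

/-- The subcomplex of the faces that contain no member of `T`. -/
def deletion (Δ : LowerSet (Finset V)) (T : Finset (Finset V)) : LowerSet (Finset V) where
  carrier := {F | F ∈ Δ ∧ ∀ τ ∈ T, ¬ τ ⊆ F}
  lower' := fun _ _ hGF hF => ⟨Δ.lower hGF hF.1, fun τ hτ h => hF.2 τ hτ (h.trans hGF)⟩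

lemma mem_deletion {Δ : LowerSet (Finset V)} {T : Finset (Finset V)} {F : Finset V} :
    F ∈ deletion Δ T ↔ F ∈ Δ ∧ ∀ τ ∈ T, ¬ τ ⊆ F := Iff.rfl

lemma deletion_empty (Δ : LowerSet (Finset V)) : deletion Δ ∅ = Δ := by
  ext F
  change F ∈ deletion Δ ∅ ↔ F ∈ Δ
  simp [mem_deletion]

lemma deletion_insert (Δ : LowerSet (Finset V)) (T : Finset (Finset V)) (τ : Finset V) :
    deletion Δ (insert τ T) = deletion (deletion Δ T) {τ} := by
  ext F
  change F ∈ deletion Δ (insert τ T) ↔ F ∈ deletion (deletion Δ T) {τ}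
  simp only [mem_deletion, Finset.forall_mem_insert, Finset.mem_singleton, forall_eq]
  tauto

/-- If the link of a face `τ` is a cone with apex `w`, then the faces that contain `τ` can be
removed without changing the homotopy type. -/
theorem contractibleSpace_realization_of_deletion_singleton {Δ : LowerSet (Finset V)}
    {τ : Finset V} (hτ : τ.Nonempty) {w : V} (hw : w ∉ τ)
    (h : ∀ F ∈ Δ, τ ⊆ F → insert w F ∈ Δ)
    [ContractibleSpace (realization (deletion Δ {τ}))] : ContractibleSpace (realization Δ) := by
  let m : (V → ℝ) → ℝ := fun x => τ.inf' hτ x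
  have hmc : Continuous m := Continuous.finset_inf'_apply hτ fun v _ => continuous_apply v
  have hmle : ∀ x : V → ℝ, ∀ v ∈ τ, m x ≤ x v := fun x v hv => Finset.inf'_le x hv
  have hm0 : ∀ x ∈ stdSimplex ℝ V, 0 ≤ m x := fun x hx => Finset.le_inf' hτ _ fun v _ => hx.1 v
  -- Every vertex of `τ` gives up the minimal mass `m x` and `w` receives all of it. Some vertex of
  -- `τ` then has mass 0, and points where one already had are fixed.
  let r : (V → ℝ) → (V → ℝ) := fun x v =>
    x v + m x * ((if v = w then (τ.card : ℝ) else 0) - if v ∈ τ then 1 else 0)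
  have hrc : Continuous r := by
    refine continuous_pi fun v => ?_
    fun_prop
  have hrτ : ∀ x, ∀ v ∈ τ, r x v = x v - m x := by
    intro x v hv
    have : v ≠ w := fun h => hw (h ▸ hv)
    simp only [r, if_neg this, if_pos hv]
    ring
  have hrw : ∀ x, r x w = x w + m x * τ.card := by
    intro x
    simp [r, hw]
  have hro : ∀ x, ∀ v ∉ τ, v ≠ w → r x v = x v := by
    intro x v hv hvw
    simp [r, hv, hvw]
  have hrs : ∀ x ∈ stdSimplex ℝ V, r x ∈ stdSimplex ℝ V := by
    intro x hx
    refine ⟨fun v => ?_, ?_⟩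
    · by_cases hv : v ∈ τ
      · rw [hrτ x v hv]
        exact sub_nonneg.2 (hmle x v hv)
      · by_cases hvw : v = w
        · rw [hvw, hrw]
          have := hm0 x hx
          have := hx.1 w
          positivity
        · rw [hro x v hv hvw]
          exact hx.1 v
    · simp only [r, Finset.sum_add_distrib, ← Finset.mul_sum, Finset.sum_sub_distrib]
      simp [hx.2]
  have hsupp : ∀ x ∈ realization Δ, ∃ F ∈ Δ, Function.support x ⊆ F ∧
      Function.support (r x) ⊆ F := by
    intro x hx
    rw [mem_realization_iff] at hx
    obtain ⟨hx, hF⟩ := hx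
    rcases (hm0 x hx).eq_or_lt with hm | hm
    · refine ⟨_, hF, fun v hv => by simpa using hv, fun v hv => ?_⟩
      simpa [r, ← hm] using hv
    · refine ⟨_, h _ hF fun v hv => ?_, fun v hv => ?_, fun v hv => ?_⟩
      · simpa using (hm.trans_le (hmle x v hv)).ne'
      · simpa using Or.inr hv
      · by_cases hvw : v = w
        · simp [hvw]
        · by_cases hvτ : v ∈ τ
          · simpa [hvw] using (hm.trans_le (hmle x v hvτ)).ne'
          · rw [Function.mem_support, hro x v hvτ hvw] at hv
            simpa [hvw] using hv
  have hsub : deletion Δ {τ} ≤ Δ := fun F hF => hF.1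
  have hrmem : ∀ x : realization Δ, r x ∈ realization (deletion Δ {τ}) := by
    intro x
    rw [mem_realization_iff]
    refine ⟨hrs x x.2.1, ?_, ?_⟩
    · obtain ⟨F, hF, -, hrF⟩ := hsupp x x.2
      exact Δ.lower (fun v hv => hrF (Finset.mem_filter.1 hv).2) hF
    · intro τ' hτ' hsub
      rw [Finset.mem_singleton.1 hτ'] at hsub
      obtain ⟨v, hv, hvm⟩ := Finset.exists_mem_eq_inf' hτ x.1
      refine (Finset.mem_filter.1 (hsub hv)).2 ?_
      rw [hrτ _ _ hv]
      exact sub_eq_zero.2 hvm.symm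
  have hrfix : ∀ x ∈ realization (deletion Δ {τ}), r x = x := by
    intro x hx
    rw [mem_realization_iff] at hx
    have hm : m x = 0 := by
      refine le_antisymm ?_ (hm0 x hx.1)
      by_contra hm
      refine hx.2.2 τ (Finset.mem_singleton_self τ) fun v hv => ?_
      simpa using ((not_le.1 hm).trans_le (hmle x v hv)).ne'
    ext v
    simp [r, hm]
  let inc : C(realization (deletion Δ {τ}), realization Δ) :=
    ⟨Set.inclusion (realization_mono hsub), continuous_inclusion _⟩
  let ρ : C(realization Δ, realization (deletion Δ {τ})) :=
    ⟨fun x => ⟨r x, hrmem x⟩, by fun_prop⟩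
  refine ContinuousMap.HomotopyEquiv.contractibleSpace
    (Y := realization (deletion Δ {τ})) ⟨ρ, inc, ?_, ?_⟩
  · refine (homotopic_of_segment_subset _ _ fun x => ?_).symm
    obtain ⟨F, hF, hxF, hrF⟩ := hsupp x x.2
    exact segment_subset_realization hF x.2.1 (hrs x x.2.1) hxF hrF
  · have : ρ.comp inc = ContinuousMap.id _ := by
      ext1 x
      exact Subtype.ext (hrfix x x.2)
    rw [this]

/-- A family version of `contractibleSpace_realization_of_deletion_singleton`. -/
theorem contractibleSpace_realization_of_deletion {Δ : LowerSet (Finset V)}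
    (w : Finset V → V) (T : Finset (Finset V))
    (hT : ∀ τ ∈ T, τ.Nonempty ∧ w τ ∉ τ ∧ ∀ F ∈ Δ, τ ⊆ F → insert (w τ) F ∈ Δ ∧
      ∀ τ' ∈ T, τ' ⊆ insert (w τ) F → τ' = τ)
    (hc : ContractibleSpace (realization (deletion Δ T))) :
    ContractibleSpace (realization Δ) := by
  induction T using Finset.induction_on with
  | empty => rwa [deletion_empty] at hc
  | insert τ T hτT ih =>
    rw [deletion_insert] at hc
    refine ih (fun ρ hρ => ?_) ?_
    · obtain ⟨h1, h2, h3⟩ := hT ρ (Finset.mem_insert_of_mem hρ)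
      exact ⟨h1, h2, fun F hF hρF => ⟨(h3 F hF hρF).1, fun τ' hτ' =>
        (h3 F hF hρF).2 τ' (Finset.mem_insert_of_mem hτ')⟩⟩
    -- Adding the apex `w τ` to a face through `τ` creates no other member of the family, so the
    -- link of `τ` remains a cone after the others are deleted.
    · obtain ⟨h1, h2, h3⟩ := hT τ (Finset.mem_insert_self _ _)
      refine contractibleSpace_realization_of_deletion_singleton h1 h2 fun F hF hτF => ?_
      refine ⟨(h3 F hF.1 hτF).1, fun ρ hρ hρF => hτT ?_⟩
      rwa [← (h3 F hF.1 hτF).2 ρ (Finset.mem_insert_of_mem hρ) hρF]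

/-! ### Removing facets -/

/-- The standard simplex is a ball. -/
theorem exists_ball_parametrization_stdSimplex (d : ℕ) :
    ∃ φ : C(Ball d, Fin (d + 1) → ℝ), Function.Injective φ ∧
      Set.range φ = stdSimplex ℝ (Fin (d + 1)) ∧ ∀ y, ‖y.1‖ = 1 ↔ ∃ i, φ y i = 0 := by
  -- A nondegenerate simplex in `ℝ^d` is a convex body, so a homeomorphism of `ℝ^d` carries it to
  -- the ball and interior to interior; barycentric coordinates identify it with the standard
  -- simplex.
  obtain ⟨b⟩ : Nonempty (AffineBasis (Fin (d + 1)) ℝ (EuclideanSpace ℝ (Fin d))) :=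
    AffineBasis.exists_affineBasis_of_finiteDimensional (by simp)
  let s := convexHull ℝ (Set.range b)
  have hmem : ∀ x, x ∈ s ↔ ∀ i, 0 ≤ b.coord i x := fun x => by
    simp only [s, AffineBasis.convexHull_eq_nonneg_coord]; rfl
  have hint : ∀ x, x ∈ interior s ↔ ∀ i, 0 < b.coord i x := fun x => by
    simp only [s, AffineBasis.interior_convexHull]; rfl
  have hcomp : IsCompact s := (Set.finite_range b).isCompact_convexHull ℝ
  have hne : (interior s).Nonempty :=
    interior_convexHull_nonempty_iff_affineSpan_eq_top.2 b.tot
  obtain ⟨h, hi, hcl, -⟩ := exists_homeomorph_image_interior_closure_frontier_eq_unitBall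
    (convex_convexHull ℝ _) hne hcomp.isBounded
  rw [hcomp.isClosed.closure_eq] at hcl
  have hs : ∀ z, h.symm z ∈ s ↔ ‖z‖ ≤ 1 := by
    intro z
    rw [← mem_closedBall_zero_iff, ← hcl, h.image_eq_preimage_symm]
    rfl
  have hs' : ∀ z, h.symm z ∈ interior s ↔ ‖z‖ < 1 := by
    intro z
    rw [← mem_ball_zero_iff, ← hi, h.image_eq_preimage_symm]
    rfl
  have hcoord : ∀ i, Continuous (b.coord i) := fun i => continuous_barycentric_coord b i
  refine ⟨⟨fun y i => b.coord i (h.symm y.1), ?_⟩, ?_, ?_, ?_⟩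
  · exact continuous_pi fun i => (hcoord i).comp (h.symm.continuous.comp continuous_subtype_val)
  · intro y z hyz
    apply Subtype.ext
    apply h.symm.injective
    exact b.ext_elem fun i => congrFun hyz i
  · ext c
    constructor
    · rintro ⟨y, rfl⟩
      exact ⟨(hmem _).1 ((hs _).2 y.norm_le), b.sum_coord_apply_eq_one _⟩
    · rintro ⟨hc0, hc1⟩
      let x := Finset.univ.affineCombination ℝ b c
      have hx : ∀ i, b.coord i x = c i := fun i =>
        b.coord_apply_combination_of_mem (Finset.mem_univ i) hc1
      refine ⟨⟨h x, ?_⟩, ?_⟩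
      · rw [mem_closedBall_zero_iff, ← hs, h.symm_apply_apply, hmem]
        simpa [hx] using hc0
      · ext i
        simp [hx]
  · intro y
    have h1 : ‖y.1‖ = 1 ↔ ¬ ‖y.1‖ < 1 := by
      rw [not_lt]
      exact ⟨fun h => h.ge, fun h => le_antisymm y.norm_le h⟩
    rw [h1, ← hs', hint, not_forall]
    refine exists_congr fun i => ?_
    have := (hmem _).1 ((hs _).2 y.norm_le) i
    rw [not_lt]
    exact ⟨fun h => le_antisymm h this, fun h => le_of_eq h⟩

/-- The closed simplex spanned by a set of `d + 1` vertices is a ball. -/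
theorem exists_ball_parametrization_face {d : ℕ} (F : Finset V) (hF : F.card = d + 1) :
    ∃ φ : C(Ball d, V → ℝ), Function.Injective φ ∧
      (∀ x, x ∈ Set.range φ ↔ x ∈ stdSimplex ℝ V ∧ Function.support x ⊆ F) ∧
      ∀ y, ‖y.1‖ = 1 ↔ ∃ v ∈ F, φ y v = 0 := by
  obtain ⟨ψ, hinj, hrange, hbd⟩ := exists_ball_parametrization_stdSimplex d
  let e : F ≃ Fin (d + 1) := F.equivFinOfCardEq hF
  let ext : (Fin (d + 1) → ℝ) → (V → ℝ) := fun c v => if h : v ∈ F then c (e ⟨v, h⟩) else 0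
  have hext : ∀ c i, ext c (e.symm i).1 = c i := fun c i => by simp [ext]
  have hext0 : ∀ c, ∀ v ∉ F, ext c v = 0 := fun c v hv => by simp [ext, hv]
  have hsum : ∀ x : V → ℝ, (∀ v ∉ F, x v = 0) → ∑ v, x v = ∑ i, x (e.symm i).1 := by
    intro x hx
    rw [← Finset.sum_subset (Finset.subset_univ F) fun v _ hv => hx v hv, ← Finset.sum_coe_sort F]
    exact (Equiv.sum_comp e.symm fun v => x v.1).symm
  have hextc : Continuous ext := by
    refine continuous_pi fun v => ?_
    by_cases hv : v ∈ F
    · simp only [ext, dif_pos hv]; fun_prop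
    · simp only [ext, dif_neg hv]; fun_prop
  refine ⟨⟨fun y => ext (ψ y), by fun_prop⟩, ?_, ?_, ?_⟩
  · intro y z hyz
    apply hinj
    ext i
    rw [← hext (ψ y), ← hext (ψ z)]
    exact congrFun hyz _
  · intro x
    constructor
    · rintro ⟨y, rfl⟩
      have hy : ψ y ∈ stdSimplex ℝ (Fin (d + 1)) := hrange ▸ ⟨y, rfl⟩
      refine ⟨⟨fun v => ?_, ?_⟩, fun v hv => ?_⟩
      · by_cases hv : v ∈ F
        · simpa [ext, hv] using hy.1 _
        · simp [ext, hv]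
      · refine (hsum _ (hext0 (ψ y))).trans ?_
        simp only [hext]
        exact hy.2
      · by_contra hvF
        exact hv (hext0 _ v hvF)
    · rintro ⟨hx, hxF⟩
      have hx0 : ∀ v ∉ F, x v = 0 := fun v hv => by_contra fun h => hv (hxF h)
      have : (fun i => x (e.symm i).1) ∈ stdSimplex ℝ (Fin (d + 1)) :=
        ⟨fun i => hx.1 _, by rw [← hsum x hx0]; exact hx.2⟩
      rw [← hrange] at this
      obtain ⟨y, hy⟩ := this
      refine ⟨y, ?_⟩
      ext v
      by_cases hv : v ∈ F
      · simp [ext, hv, hy]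
      · simp [ext, hv, hx0]
  · intro y
    rw [hbd]
    constructor
    · rintro ⟨i, hi⟩
      exact ⟨(e.symm i).1, (e.symm i).2, (hext _ _).trans hi⟩
    · rintro ⟨v, hv, h⟩
      refine ⟨e ⟨v, hv⟩, ?_⟩
      rw [← hext (ψ y)]
      simpa using h

/-- Compactness of the subcomplex makes gluing the cells to it a quotient map onto the whole
complex. -/
lemma isCompact_realization (Δ : LowerSet (Finset V)) : IsCompact (realization Δ) := by
  have : realization Δ = ⋃ F ∈ {F : Finset V | F ∈ Δ},
      stdSimplex ℝ V ∩ ⋂ v ∈ {v : V | v ∉ F}, {x | x v = 0} := by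
    ext x
    simp only [realization, Set.mem_ofPred_eq, Set.mem_iUnion, Set.mem_inter_iff, Set.mem_iInter,
      exists_prop, Function.support_subset_iff']
    constructor
    · rintro ⟨hx, F, hF, h⟩
      exact ⟨F, hF, hx, h⟩
    · rintro ⟨F, hF, hx, h⟩
      exact ⟨hx, F, hF, h⟩
  rw [this]
  refine Set.Finite.isCompact_biUnion (Set.toFinite _) fun F _ => ?_
  refine (isCompact_stdSimplex ℝ V).inter_right ?_
  exact isClosed_biInter fun v _ => isClosed_eq (continuous_apply v) continuous_const

/-- If a contractible complex is obtained from `Δ` by removing `m` facets with `d + 1` vertices,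
then `Δ` is homotopy equivalent to the wedge of `m` spheres of dimension `d`. -/
theorem homotopyEquiv_wedgeOfSpheres {Δ Δ' : LowerSet (Finset V)} (hle : Δ' ≤ Δ)
    [ContractibleSpace (realization Δ')] {d m : ℕ}
    (hcard : ∀ F ∈ Δ, F ∉ Δ' → F.card = d + 1)
    (hm : Nat.card {F // F ∈ Δ ∧ F ∉ Δ'} = m) :
    Nonempty (ContinuousMap.HomotopyEquiv (realization Δ) (WedgeOfSpheres m d)) := by
  let e : Fin m ≃ {F // F ∈ Δ ∧ F ∉ Δ'} := (Finite.equivFinOfCardEq hm).symm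
  choose ψ hinj hrange hbd using fun j : Fin m =>
    exists_ball_parametrization_face (e j).1 (hcard _ (e j).2.1 (e j).2.2)
  have hmem : ∀ j y, ψ j y ∈ stdSimplex ℝ V ∧ Function.support (ψ j y) ⊆ (e j).1 :=
    fun j y => (hrange j _).1 ⟨y, rfl⟩
  let φ : Fin m → C(Ball d, realization Δ) := fun j =>
    ⟨fun y => ⟨ψ j y, (hmem j y).1, _, (e j).2.1, (hmem j y).2⟩, by fun_prop⟩
  -- All removed faces have the same size, so a proper subset of one is not removed: the boundary of
  -- each cell lies in `Δ'`.
  have hproper : ∀ j, ∀ G, G ⊂ (e j).1 → G ∈ Δ' := by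
    intro j G hG
    by_contra hG'
    have h1 := hcard G (Δ.lower hG.1 (e j).2.1) hG'
    have h2 := hcard _ (e j).2.1 (e j).2.2
    exact (Finset.card_lt_card hG).ne (h1.trans h2.symm)
  let i : realization Δ' → realization Δ := Set.inclusion (realization_mono hle)
  have hi : ∀ x : realization Δ, x ∈ Set.range i ↔ x.1 ∈ realization Δ' := by
    intro x
    rw [Set.range_inclusion]
    rfl
  have hsupp : ∀ j y, (∃ v ∈ (e j).1, ψ j y v = 0) ∨
      Finset.univ.filter (fun v => ψ j y v ≠ 0) = (e j).1 := by
    intro j y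
    by_cases h : ∃ v ∈ (e j).1, ψ j y v = 0
    · exact Or.inl h
    · push Not at h
      refine Or.inr (Finset.ext fun v => ?_)
      simp only [Finset.mem_filter, Finset.mem_univ, true_and]
      exact ⟨fun hv => (hmem j y).2 hv, h v⟩
  have hbd' : ∀ j y, φ j y ∈ Set.range i ↔ ‖y.1‖ = 1 := by
    intro j y
    rw [hi, hbd, mem_realization_iff]
    change (ψ j y ∈ _ ∧ _) ↔ _
    constructor
    · rintro ⟨-, h⟩
      rcases hsupp j y with h' | h'
      · exact h'
      · exact absurd (h' ▸ h) (e j).2.2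
    · rintro ⟨v, hv, h⟩
      refine ⟨(hmem j y).1, hproper j _ ?_⟩
      exact ⟨fun u hu => (hmem j y).2 (Finset.mem_filter.1 hu).2,
        fun hsub => (Finset.mem_filter.1 (hsub hv)).2 h⟩
  have : CompactSpace (realization Δ') := isCompact_iff_compactSpace.1 (isCompact_realization Δ')
  refine homotopyEquiv_wedge_of_cells i (continuous_inclusion _) (Set.inclusion_injective _) φ
    ?_ hbd' ?_
  · intro x
    by_cases hx : Finset.univ.filter (fun v => x.1 v ≠ 0) ∈ Δ'
    · exact Or.inl ((hi x).2 ((mem_realization_iff _ _).2 ⟨x.2.1, hx⟩))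
    · right
      obtain ⟨j, hj⟩ := e.surjective ⟨_, ((mem_realization_iff _ _).1 x.2).2, hx⟩
      obtain ⟨y, hy⟩ := (hrange j x.1).2 ⟨x.2.1, by rw [hj]; intro v hv; simpa using hv⟩
      exact ⟨j, y, Subtype.ext hy⟩
  · intro j y j' y' hyy' hr
    have h1 := (hsupp j y).resolve_left fun h => hr ((hbd' j y).2 ((hbd j y).2 h))
    have h2 := (hsupp j' y').resolve_left fun h =>
      hr (hyy' ▸ (hbd' j' y').2 ((hbd j' y').2 h))
    have h3 : ψ j y = ψ j' y' := congrArg Subtype.val hyy'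
    have hj : j = j' := by
      apply e.injective
      apply Subtype.ext
      rw [← h1, ← h2, h3]
    subst hj
    rw [hinj j h3]

end Realization

/-! ### Squarefree powers of squarefree monomial ideals -/

section Ideals

variable {K : Type*} [Field K] {V : Type*} [DecidableEq V]

/-- The exponent of the squarefree monomial `x_F`. -/
def squarefreeExponent (F : Finset V) : V →₀ ℕ :=
  ∑ v ∈ F, Finsupp.single v 1

lemma squarefreeExponent_apply (F : Finset V) (v : V) :
    squarefreeExponent F v = if v ∈ F then 1 else 0 := by
  simp [squarefreeExponent, Finsupp.finsetSum_apply, Finsupp.single_apply]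

lemma squarefreeMonomial_eq (F : Finset V) :
    squarefreeMonomial K F = MvPolynomial.monomial (squarefreeExponent F) 1 := by
  rw [squarefreeExponent, MvPolynomial.monomial_sum_one]
  rfl

/-- The exponent of `v` on the left counts the sets `S j` through `v`: at most one for `v ∈ G`, none
otherwise. -/
lemma sum_squarefreeExponent_le_iff {k : ℕ} (S : Fin k → Finset V) (G : Finset V) :
    ∑ j, squarefreeExponent (S j) ≤ squarefreeExponent G ↔
      Pairwise (fun i j => Disjoint (S i) (S j)) ∧ ∀ j, S j ⊆ G := by
  have h : ∀ v, (∑ j, squarefreeExponent (S j)) v =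
      (Finset.univ.filter fun j => v ∈ S j).card := by
    intro v
    simp [Finsupp.finsetSum_apply, squarefreeExponent_apply]
  rw [Finsupp.le_def]
  constructor
  · intro hle
    have hle' : ∀ v, (Finset.univ.filter fun j => v ∈ S j).card ≤ if v ∈ G then 1 else 0 := by
      intro v
      rw [← h, ← squarefreeExponent_apply]
      exact hle v
    constructor
    · intro i j hij
      rw [Finset.disjoint_left]
      intro v hi hj
      refine hij (Finset.card_le_one.1 ((hle' v).trans (by split_ifs <;> simp)) i ?_ j ?_)
      · simpa using hi
      · simpa using hj
    · intro j v hv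
      by_contra hG
      have h1 := hle' v
      rw [if_neg hG, Nat.le_zero, Finset.card_eq_zero] at h1
      exact Finset.notMem_empty j (h1 ▸ by simpa using hv)
  · rintro ⟨hd, hG⟩ v
    rw [h, squarefreeExponent_apply]
    split_ifs with hv
    · refine Finset.card_le_one.2 fun i hi j hj => ?_
      by_contra hij
      exact Finset.disjoint_left.1 (hd hij) (Finset.mem_filter.1 hi).2 (Finset.mem_filter.1 hj).2
    · rw [Nat.le_zero, Finset.card_eq_zero, Finset.filter_eq_empty_iff]
      exact fun j _ hj => hv (hG j hj)

lemma monomial_mem_span_pow_iff (E : Set (Finset V)) (k : ℕ) (a : V →₀ ℕ) :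
    MvPolynomial.monomial a (1 : K) ∈ Ideal.span (squarefreeMonomial K '' E) ^ k ↔
      ∃ S : Fin k → Finset V, (∀ j, S j ∈ E) ∧ ∑ j, squarefreeExponent (S j) ≤ a := by
  classical
  have h : Ideal.span (squarefreeMonomial K '' E) ^ k = Ideal.span
      ((fun b => MvPolynomial.monomial b (1 : K)) ''
        {b | ∃ S : Fin k → Finset V, (∀ j, S j ∈ E) ∧ ∑ j, squarefreeExponent (S j) = b}) := by
    rw [Ideal.span, Submodule.span_pow, Ideal.span]
    congr 1
    ext m
    rw [Set.mem_pow]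
    constructor
    · rintro ⟨f, rfl⟩
      choose S hS hSf using fun j => (f j).2
      refine ⟨_, ⟨S, hS, rfl⟩, ?_⟩
      simp only [List.prod_ofFn, ← hSf, squarefreeMonomial_eq, MvPolynomial.monomial_sum_one]
    · rintro ⟨_, ⟨S, hS, rfl⟩, rfl⟩
      refine ⟨fun j => ⟨_, S j, hS j, rfl⟩, ?_⟩
      simp only [List.prod_ofFn, squarefreeMonomial_eq, MvPolynomial.monomial_sum_one]
  rw [h, MvPolynomial.mem_ideal_span_monomial_image, MvPolynomial.support_monomial,
    if_neg one_ne_zero]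
  simp

/-- A squarefree monomial `x_G` lies in the `k`-th squarefree power of an edge ideal if and only
if `G` contains `k` pairwise disjoint edges. -/
theorem squarefreeMonomial_mem_squarefreePower_iff [Finite V] (E : Set (Finset V)) (k : ℕ)
    (G : Finset V) :
    squarefreeMonomial K G ∈ squarefreePower (Ideal.span (squarefreeMonomial K '' E)) k ↔
      ∃ S : Fin k → Finset V, (∀ j, S j ∈ E) ∧
        Pairwise (fun i j => Disjoint (S i) (S j)) ∧ ∀ j, S j ⊆ G := by
  classical
  have h : squarefreePower (Ideal.span (squarefreeMonomial K '' E)) k = Ideal.span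
      ((fun b => MvPolynomial.monomial b (1 : K)) ''
        {a | a ∈ minimalExponents (Ideal.span (squarefreeMonomial K '' E) ^ k) ∧
          ∀ v, a v ≤ 1}) := by
    rw [squarefreePower]
    congr 1
    ext m
    simp only [Set.mem_ofPred_eq, Set.mem_image, and_assoc, eq_comm]
  simp only [← sum_squarefreeExponent_le_iff]
  rw [h, MvPolynomial.mem_ideal_span_monomial_image, squarefreeMonomial_eq,
    MvPolynomial.support_monomial, if_neg one_ne_zero]
  simp only [Finset.mem_singleton, forall_eq]
  constructor
  · rintro ⟨a, ⟨ha, -⟩, haG⟩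
    obtain ⟨S, hS, hle⟩ := (monomial_mem_span_pow_iff E k a).1 ha.1
    exact ⟨S, hS, hle.trans haG⟩
  · intro hG
    -- A minimal generator dividing a squarefree monomial is squarefree, so discarding the other
    -- generators loses nothing here.
    obtain ⟨a, haG, ha⟩ := exists_minimal_le_of_wellFoundedLT
      (fun b => MvPolynomial.monomial b (1 : K) ∈ Ideal.span (squarefreeMonomial K '' E) ^ k)
      (squarefreeExponent G) ((monomial_mem_span_pow_iff E k _).2 hG)
    refine ⟨a, ⟨ha, fun v => (haG v).trans ?_⟩, haG⟩
    rw [squarefreeExponent_apply]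
    split_ifs <;> simp

/-- The set of vertices of a path on `t` vertices. -/
def IsPathSupport (G : SimpleGraph V) (t : ℕ) (S : Finset V) : Prop :=
  ∃ (u v : V) (p : G.Walk u v), p.IsPath ∧ p.support.length = t ∧ p.support.toFinset = S

lemma pathIdeal_eq (G : SimpleGraph V) (t : ℕ) :
    pathIdeal K G t = Ideal.span (squarefreeMonomial K '' {S | IsPathSupport G t S}) := by
  rw [pathIdeal]
  congr 1
  ext m
  constructor
  · rintro ⟨u, v, p, hp, ht, rfl⟩
    exact ⟨_, ⟨u, v, p, hp, ht, rfl⟩, rfl⟩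
  · rintro ⟨_, ⟨u, v, p, hp, ht, rfl⟩, rfl⟩
    exact ⟨u, v, p, hp, ht, rfl⟩

end Ideals

lemma mem_pathDualComplex_iff_exists {K : Type*} [Field K] {n t k : ℕ} {F : Finset (Fin n)} :
    F ∈ pathDualComplex K n t k ↔ ∃ S : Fin k → Finset (Fin n),
      (∀ j, IsPathSupport (SimpleGraph.pathGraph n) t (S j)) ∧
        Pairwise (fun i j => Disjoint (S i) (S j)) ∧ ∀ j, S j ⊆ Fᶜ := by
  have h : F ∈ pathDualComplex K n t k ↔ squarefreeMonomial K Fᶜ ∈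
      squarefreePower (pathIdeal K (SimpleGraph.pathGraph n) t) k := by
    constructor
    · rintro ⟨G, hG, rfl⟩
      rw [compl_compl]
      exact not_not.1 hG
    · intro h
      exact ⟨Fᶜ, not_not.2 h, (compl_compl F).symm⟩
  rw [h, pathIdeal_eq, squarefreeMonomial_mem_squarefreePower_iff]
  rfl

/-! ### Paths in the path graph -/

/-- A discrete intermediate value theorem: each step of the walk changes the vertex by 1. -/
lemma ordConnected_support {n : ℕ} {u v : Fin n} (p : (SimpleGraph.pathGraph n).Walk u v) :
    ∀ x ∈ p.support, ∀ y ∈ p.support, ∀ z, x ≤ z → z ≤ y → z ∈ p.support := by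
  induction p with
  | nil =>
    intro x hx y hy z hxz hzy
    simp only [SimpleGraph.Walk.support_nil, List.mem_singleton] at hx hy ⊢
    subst hx hy
    exact le_antisymm hzy hxz
  | @cons u w v h p ih =>
    have hw := p.start_mem_support
    rw [SimpleGraph.pathGraph_adj] at h
    intro x hx y hy z hxz hzy
    simp only [SimpleGraph.Walk.support_cons, List.mem_cons] at hx hy ⊢
    by_cases hzu : z = u
    · exact Or.inl hzu
    right
    have hzu' : z.1 ≠ u.1 := fun h => hzu (Fin.ext h)
    rw [Fin.le_def] at hxz hzy
    rcases hx with rfl | hx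
    · rcases hy with rfl | hy
      · omega
      · refine ih w hw y hy z ?_ hzy
        rw [Fin.le_def]
        omega
    · rcases hy with rfl | hy
      · refine ih x hx w hw z hxz ?_
        rw [Fin.le_def]
        omega
      · exact ih x hx y hy z hxz hzy

lemma IsPathSupport.card_eq {n t : ℕ} {S : Finset (Fin n)}
    (h : IsPathSupport (SimpleGraph.pathGraph n) t S) : S.card = t := by
  obtain ⟨u, v, p, hp, ht, rfl⟩ := h
  rw [List.toFinset_card_of_nodup hp.support_nodup, ht]

/-- Consequently a path avoiding `v` contributes 0 or `t` to the number of covered vertices below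
`v`. -/
lemma IsPathSupport.lt_or_lt {n t : ℕ} {S : Finset (Fin n)}
    (h : IsPathSupport (SimpleGraph.pathGraph n) t S) {v : Fin n} (hv : v ∉ S) :
    (∀ x ∈ S, x < v) ∨ ∀ x ∈ S, v < x := by
  obtain ⟨u, w, p, hp, ht, rfl⟩ := h
  by_contra hcon
  push Not at hcon
  obtain ⟨⟨x, hx, hvx⟩, ⟨y, hy, hyv⟩⟩ := hcon
  exact hv (List.mem_toFinset.2 (ordConnected_support p y (List.mem_toFinset.1 hy) x
    (List.mem_toFinset.1 hx) v hyv hvx))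

lemma exists_path_interval {n : ℕ} (t : ℕ) : ∀ (s : ℕ) (hs : s < n), s + t < n →
    ∃ (v : Fin n) (p : (SimpleGraph.pathGraph n).Walk ⟨s, hs⟩ v), p.IsPath ∧
      p.support.length = t + 1 ∧ ∀ x : Fin n, x ∈ p.support ↔ s ≤ x.1 ∧ x.1 < s + (t + 1) := by
  induction t with
  | zero =>
    intro s hs _
    refine ⟨_, SimpleGraph.Walk.nil, by simp, by simp, fun x => ?_⟩
    simp only [SimpleGraph.Walk.support_nil, List.mem_singleton, Fin.ext_iff]
    omega
  | succ t ih =>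
    intro s hs hst
    obtain ⟨v, p, hp, hlen, hmem⟩ := ih (s + 1) (by omega) (by omega)
    have hadj : (SimpleGraph.pathGraph n).Adj ⟨s, hs⟩ ⟨s + 1, by omega⟩ := by
      rw [SimpleGraph.pathGraph_adj]
      exact Or.inl rfl
    refine ⟨v, SimpleGraph.Walk.cons hadj p, hp.cons fun h => ?_, by simp [hlen], fun x => ?_⟩
    · have := ((hmem _).1 h).1
      simp at this
    · simp only [SimpleGraph.Walk.support_cons, List.mem_cons, hmem, Fin.ext_iff]
      omega

lemma isPathSupport_interval {n t s : ℕ} (ht : 0 < t) (hst : s + t ≤ n) :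
    IsPathSupport (SimpleGraph.pathGraph n) t
      (Finset.univ.filter fun x : Fin n => s ≤ x.1 ∧ x.1 < s + t) := by
  obtain ⟨t, rfl⟩ := Nat.exists_eq_succ_of_ne_zero ht.ne'
  obtain ⟨v, p, hp, hlen, hmem⟩ := exists_path_interval (n := n) t s (by omega) (by omega)
  refine ⟨_, v, p, hp, hlen, ?_⟩
  ext x
  simp [hmem]

/-! ### The faces of the complex -/

/-- The faces of the complex `Δ_{n,t}^{[k]}` for `n = kt + l` with `l ≤ t`: the remainders modulo
`t` of their vertices are smaller than `l` and strictly increasing. -/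
theorem mem_pathDualComplex_iff {K : Type*} [Field K] {n t k l : ℕ} (ht : 0 < t)
    (hn : n = k * t + l) (hlt : l ≤ t) {F : Finset (Fin n)} :
    F ∈ pathDualComplex K n t k ↔ (∀ v ∈ F, v.1 % t < l) ∧
      ∀ u ∈ F, ∀ v ∈ F, u < v → u.1 % t < v.1 % t := by
  rw [mem_pathDualComplex_iff_exists]
  constructor
  · rintro ⟨S, hS, hd, hF⟩
    set U := Finset.univ.biUnion S with hU
    have hUF : F ⊆ Uᶜ := by
      intro v hv
      rw [Finset.mem_compl]
      intro hvU
      simp only [hU, Finset.mem_biUnion, Finset.mem_univ, true_and] at hvU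
      obtain ⟨j, hj⟩ := hvU
      exact Finset.mem_compl.1 (hF j hj) hv
    have hUcard : U.card = k * t := by
      rw [hU, Finset.card_biUnion fun i _ j _ hij => hd hij]
      simp [fun j => (hS j).card_eq]
    have hGcard : Uᶜ.card = l := by
      rw [Finset.card_compl, hUcard, Fintype.card_fin]
      omega
    -- The `v` vertices below a free vertex `v` split into covered ones, a multiple of `t` in
    -- number, and free ones, fewer than `l ≤ t`.
    have key : ∀ v ∈ Uᶜ, v.1 % t = (Uᶜ.filter (· < v)).card ∧ (Uᶜ.filter (· < v)).card < l := by
      intro v hv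
      have h1 : (Uᶜ.filter (· < v)).card < l := by
        rw [← hGcard]
        refine Finset.card_lt_card (Finset.filter_ssubset.2 ⟨v, hv, lt_irrefl v⟩)
      have h2 : (Finset.univ.filter (· < v)).card = v.1 := by
        rw [Finset.filter_gt_eq_Iio, Fin.card_Iio]
      have h3 : (Finset.univ.filter (· < v)).card =
          (U.filter (· < v)).card + (Uᶜ.filter (· < v)).card := by
        rw [← Finset.card_union_of_disjoint, ← Finset.filter_union, Finset.union_compl]
        exact Finset.disjoint_filter_filter disjoint_compl_right
      have h4 : t ∣ (U.filter (· < v)).card := by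
        rw [hU, Finset.filter_biUnion, Finset.card_biUnion fun i _ j _ hij =>
          Finset.disjoint_filter_filter (hd hij)]
        refine Finset.dvd_sum fun j _ => ?_
        have hvj : v ∉ S j := fun h =>
          Finset.mem_compl.1 hv (Finset.mem_biUnion.2 ⟨j, Finset.mem_univ j, h⟩)
        rcases (hS j).lt_or_lt hvj with h | h
        · rw [Finset.filter_true_of_mem h, (hS j).card_eq]
        · rw [Finset.filter_false_of_mem fun x hx => (h x hx).not_gt, Finset.card_empty]
          exact dvd_zero t
      refine ⟨?_, h1⟩
      obtain ⟨q, hq⟩ := h4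
      rw [← h2, h3, hq, Nat.mul_add_mod, Nat.mod_eq_of_lt (h1.trans_le hlt)]
    refine ⟨fun v hv => ?_, fun u hu v hv huv => ?_⟩
    · rw [(key v (hUF hv)).1]
      exact (key v (hUF hv)).2
    · rw [(key v (hUF hv)).1, (key u (hUF hu)).1]
      refine Finset.card_lt_card ⟨fun x hx => ?_, fun h => ?_⟩
      · rw [Finset.mem_filter] at hx ⊢
        exact ⟨hx.1, hx.2.trans huv⟩
      · exact lt_irrefl u (Finset.mem_filter.1 (h (Finset.mem_filter.2 ⟨hUF hu, huv⟩))).2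
  · rintro ⟨hF1, hF2⟩
    -- The `j`-th path will start at `t * j + c j`. The shift `c j` is just large enough to pass
    -- every vertex of `F` in the blocks up to `j`; it is 0 if there are none.
    let c : ℕ → ℕ := fun a => (F.filter fun v => v.1 / t ≤ a).sup fun v => v.1 % t + 1
    have hcl : ∀ a, c a ≤ l := fun a =>
      Finset.sup_le fun v hv => hF1 v (Finset.mem_filter.1 hv).1
    have hcmono : ∀ a b, a ≤ b → c a ≤ c b := fun a b hab =>
      Finset.sup_mono fun v hv => by
        rw [Finset.mem_filter] at hv ⊢
        exact ⟨hv.1, hv.2.trans hab⟩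
    have hdisj : ∀ a b, a < b → t * a + c a + t ≤ t * b + c b := by
      intro a b hab
      have h1 := hcmono a b hab.le
      have h2 : t * (a + 1) ≤ t * b := Nat.mul_le_mul_left t hab
      rw [mul_add, mul_one] at h2
      omega
    refine ⟨fun j => Finset.univ.filter fun x : Fin n =>
      t * j.1 + c j.1 ≤ x.1 ∧ x.1 < t * j.1 + c j.1 + t, fun j => ?_, fun i j hij => ?_,
      fun j v hv => ?_⟩
    · refine isPathSupport_interval ht ?_
      have h1 := hcl j.1
      have h2 : t * (j.1 + 1) ≤ t * k := Nat.mul_le_mul_left t j.2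
      rw [mul_add, mul_one, mul_comm t k] at h2
      omega
    · refine Finset.disjoint_left.2 fun x hx hy => ?_
      simp only [Finset.mem_filter, Finset.mem_univ, true_and] at hx hy
      rcases lt_or_gt_of_ne (fun h => hij (Fin.ext h) : i.1 ≠ j.1) with h | h
      · have := hdisj _ _ h
        omega
      · have := hdisj _ _ h
        omega
    · simp only [Finset.mem_filter, Finset.mem_univ, true_and] at hv
      rw [Finset.mem_compl]
      intro hvF
      have hdiv := Nat.div_add_mod v.1 t
      rcases le_or_gt (v.1 / t) j.1 with h | h
      · have h1 : v.1 % t + 1 ≤ c j.1 :=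
          Finset.le_sup (f := fun v : Fin n => v.1 % t + 1) (Finset.mem_filter.2 ⟨hvF, h⟩)
        have h2 := Nat.mul_le_mul_left t h
        omega
      · have h2 : t * (j.1 + 1) ≤ t * (v.1 / t) := Nat.mul_le_mul_left t h
        rw [mul_add, mul_one] at h2
        -- Here `v` can only lie in block `j + 1`, and some `u ∈ F` in an earlier block has at least
        -- its residue, against strict increase.
        have h3 : v.1 % t < c j.1 := by omega
        obtain ⟨u, hu, hvu⟩ := Finset.lt_sup_iff.1 h3
        rw [Finset.mem_filter] at hu
        have huv : u < v := by
          rw [Fin.lt_def]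
          by_contra hcon
          have := Nat.div_le_div_right (c := t) (not_lt.1 hcon)
          omega
        have := hF2 u hu.1 v hvF huv
        omega

/-! ### Initial chains -/

section Chains

variable {n t : ℕ}

/-- The sets of vertices `t * q i + i`, one for each `i < j`, with `0 < q 0 < q 1 < ⋯`. -/
structure IsInitialChain (t j : ℕ) (τ : Finset (Fin n)) : Prop where
  mod_lt : ∀ v ∈ τ, v.1 % t < j
  exists_mod : ∀ i < j, ∃ v ∈ τ, v.1 % t = i
  div_pos : ∀ v ∈ τ, 0 < v.1 / t
  lt : ∀ u ∈ τ, ∀ v ∈ τ, u < v → u.1 / t < v.1 / t ∧ u.1 % t < v.1 % t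

open Classical in
/-- The finite set of all initial chains of length `j`. -/
def initialChains (n t j : ℕ) : Finset (Finset (Fin n)) :=
  Finset.univ.filter (IsInitialChain t j)

lemma mem_initialChains {j : ℕ} {τ : Finset (Fin n)} :
    τ ∈ initialChains n t j ↔ IsInitialChain t j τ := by
  simp [initialChains]

lemma injOn_mod {F : Finset (Fin n)}
    (hF : ∀ u ∈ F, ∀ v ∈ F, u < v → u.1 % t < v.1 % t) :
    Set.InjOn (fun v : Fin n => v.1 % t) F := by
  intro u hu v hv huv
  rcases lt_trichotomy u v with h | h | h
  · exact absurd huv (hF u hu v hv h).ne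
  · exact h
  · exact absurd huv (hF v hv u hu h).ne'

lemma eq_of_div_mod {u v : Fin n} (h1 : u.1 / t = v.1 / t) (h2 : u.1 % t = v.1 % t) : u = v := by
  ext
  rw [← Nat.div_add_mod u.1 t, ← Nat.div_add_mod v.1 t, h1, h2]

namespace IsInitialChain

variable {j : ℕ} {τ : Finset (Fin n)}

lemma injOn_mod (h : IsInitialChain t j τ) : Set.InjOn (fun v : Fin n => v.1 % t) τ :=
  TYoung.injOn_mod fun u hu v hv huv => (h.lt u hu v hv huv).2

lemma injOn_div (h : IsInitialChain t j τ) : Set.InjOn (fun v : Fin n => v.1 / t) τ := by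
  intro u hu v hv huv
  rcases lt_trichotomy u v with h' | h' | h'
  · exact absurd huv (h.lt u hu v hv h').1.ne
  · exact h'
  · exact absurd huv (h.lt v hv u hu h').1.ne'

lemma card_eq (h : IsInitialChain t j τ) : τ.card = j := by
  rw [← Finset.card_image_of_injOn h.injOn_mod, ← Finset.card_range j]
  congr 1
  ext i
  rw [Finset.mem_image, Finset.mem_range]
  constructor
  · rintro ⟨v, hv, rfl⟩
    exact h.mod_lt v hv
  · exact h.exists_mod i

/-- Long chains contain short ones, so the successive deletions are nested. -/
lemma filter_mod_lt {i : ℕ} (hij : i ≤ j) (h : IsInitialChain t j τ) :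
    IsInitialChain t i (τ.filter fun v => v.1 % t < i) where
  mod_lt v hv := (Finset.mem_filter.1 hv).2
  exists_mod a ha := by
    obtain ⟨v, hv, hva⟩ := h.exists_mod a (ha.trans_le hij)
    exact ⟨v, Finset.mem_filter.2 ⟨hv, hva ▸ ha⟩, hva⟩
  div_pos v hv := h.div_pos v (Finset.mem_filter.1 hv).1
  lt u hu v hv := h.lt u (Finset.mem_filter.1 hu).1 v (Finset.mem_filter.1 hv).1

/-- The quotients of an initial chain determine its remainders. -/
lemma mod_eq_card (h : IsInitialChain t j τ) {v : Fin n} (hv : v ∈ τ) :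
    v.1 % t = ((τ.image fun u => u.1 / t).filter (· < v.1 / t)).card := by
  have hlt : ∀ u ∈ τ, u.1 / t < v.1 / t ↔ u < v := by
    intro u hu
    refine ⟨fun huv => ?_, fun huv => (h.lt u hu v hv huv).1⟩
    by_contra hcon
    exact huv.not_ge (Nat.div_le_div_right (not_lt.1 hcon))
  rw [Finset.filter_image, Finset.filter_congr hlt,
    Finset.card_image_of_injOn (h.injOn_div.mono (Finset.coe_subset.2 (Finset.filter_subset _ _))),
    ← Finset.card_image_of_injOn
      (h.injOn_mod.mono (Finset.coe_subset.2 (Finset.filter_subset (· < v) _)))]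
  rw [← Finset.card_range (v.1 % t)]
  congr 1
  ext i
  simp only [Finset.mem_range, Finset.mem_image, Finset.mem_filter]
  constructor
  · intro hi
    obtain ⟨u, hu, rfl⟩ := h.exists_mod i (hi.trans (h.mod_lt v hv))
    refine ⟨u, ⟨hu, ?_⟩, rfl⟩
    rcases lt_trichotomy u v with h' | rfl | h'
    · exact h'
    · exact absurd hi (lt_irrefl _)
    · exact absurd hi (h.lt v hv u hu h').2.not_gt
  · rintro ⟨u, ⟨hu, huv⟩, rfl⟩
    exact (h.lt u hu v hv huv).2

end IsInitialChain

/-- The number of initial chains of length `l` is `k.choose l`. -/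
theorem card_initialChains {k l : ℕ} (ht : 0 < t) (hn : n = k * t + l) (hlt : l ≤ t) :
    (initialChains n t l).card = k.choose l := by
  have hcard : (Finset.powersetCard l (Finset.Icc 1 k)).card = k.choose l := by simp
  rw [← hcard]
  -- The inverse of taking quotients: each `s ∈ S` is given its rank in `S` as residue.
  let vert : Finset ℕ → Finset (Fin n) := fun S => Finset.univ.filter fun v =>
    v.1 / t ∈ S ∧ v.1 % t = (S.filter (· < v.1 / t)).card
  have hvert : ∀ S v, v ∈ vert S ↔ v.1 / t ∈ S ∧ v.1 % t = (S.filter (· < v.1 / t)).card :=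
    fun S v => by simp [vert]
  have hrank : ∀ S ∈ Finset.powersetCard l (Finset.Icc 1 k), ∀ s ∈ S,
      (S.filter (· < s)).card < l := by
    intro S hS s hs
    rw [← (Finset.mem_powersetCard.1 hS).2]
    exact Finset.card_lt_card (Finset.filter_ssubset.2 ⟨s, hs, lt_irrefl s⟩)
  have hmono : ∀ S : Finset ℕ, ∀ s ∈ S, ∀ s', s < s' →
      (S.filter (· < s)).card < (S.filter (· < s')).card := by
    intro S s hs s' hss'
    refine Finset.card_lt_card ⟨fun x hx => ?_, fun h => ?_⟩
    · rw [Finset.mem_filter] at hx ⊢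
      exact ⟨hx.1, hx.2.trans hss'⟩
    · exact lt_irrefl s (Finset.mem_filter.1 (h (Finset.mem_filter.2 ⟨hs, hss'⟩))).2
  have hex : ∀ S ∈ Finset.powersetCard l (Finset.Icc 1 k), ∀ s ∈ S, ∃ v ∈ vert S,
      v.1 / t = s ∧ v.1 % t = (S.filter (· < s)).card := by
    intro S hS s hs
    have h1 := hrank S hS s hs
    have h2 : s ≤ k := (Finset.mem_Icc.1 ((Finset.mem_powersetCard.1 hS).1 hs)).2
    have h3 : t * s ≤ t * k := Nat.mul_le_mul_left t h2
    have h4 : t * s + (S.filter (· < s)).card < n := by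
      rw [hn, mul_comm k t]
      omega
    have h5 : (t * s + (S.filter (· < s)).card) / t = s := by
      rw [Nat.mul_add_div ht, Nat.div_eq_of_lt (h1.trans_le hlt), add_zero]
    have h6 : (t * s + (S.filter (· < s)).card) % t = (S.filter (· < s)).card := by
      rw [Nat.mul_add_mod, Nat.mod_eq_of_lt (h1.trans_le hlt)]
    refine ⟨⟨_, h4⟩, (hvert _ _).2 ?_, h5, h6⟩
    simp only [h5, h6]
    exact ⟨hs, trivial⟩
  refine Finset.card_nbij' (fun F => F.image fun v => v.1 / t) vert ?_ ?_ ?_ ?_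
  · intro F hF
    have hF := mem_initialChains.1 hF
    refine Finset.mem_coe.2 (Finset.mem_powersetCard.2 ⟨fun q hq => ?_, ?_⟩)
    · obtain ⟨v, hv, rfl⟩ := Finset.mem_image.1 hq
      refine Finset.mem_Icc.2 ⟨hF.div_pos v hv, ?_⟩
      rw [← Nat.lt_succ_iff, Nat.div_lt_iff_lt_mul ht, Nat.succ_mul]
      exact v.2.trans_le (by omega)
    · rw [Finset.card_image_of_injOn hF.injOn_div, hF.card_eq]
  · intro S hS
    have hS := Finset.mem_coe.1 hS
    have hSc := (Finset.mem_powersetCard.1 hS).2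
    refine Finset.mem_coe.2 (mem_initialChains.2 ⟨fun v hv => ?_, fun i hi => ?_, fun v hv => ?_,
      fun u hu v hv huv => ?_⟩)
    · obtain ⟨h1, h2⟩ := (hvert S v).1 hv
      rw [h2]
      exact hrank S hS _ h1
    · have himage : S.image (fun s => (S.filter (· < s)).card) = Finset.range l := by
        refine Finset.eq_of_subset_of_card_le (fun x hx => ?_) ?_
        · obtain ⟨s, hs, rfl⟩ := Finset.mem_image.1 hx
          exact Finset.mem_range.2 (hrank S hS s hs)
        · rw [Finset.card_image_of_injOn, hSc, Finset.card_range]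
          intro s hs s' hs' hss'
          rcases lt_trichotomy s s' with h | h | h
          · exact absurd hss' (hmono S s hs s' h).ne
          · exact h
          · exact absurd hss' (hmono S s' hs' s h).ne'
      obtain ⟨s, hs, rfl⟩ := Finset.mem_image.1 (himage ▸ Finset.mem_range.2 hi)
      obtain ⟨v, hv, -, hvs⟩ := hex S hS s hs
      exact ⟨v, hv, hvs⟩
    · exact (Finset.mem_Icc.1 ((Finset.mem_powersetCard.1 hS).1 ((hvert S v).1 hv).1)).1
    · obtain ⟨hu1, hu2⟩ := (hvert S u).1 hu
      obtain ⟨hv1, hv2⟩ := (hvert S v).1 hv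
      have h1 : u.1 / t < v.1 / t := by
        refine lt_of_le_of_ne (Nat.div_le_div_right huv.le) fun h => huv.ne ?_
        exact eq_of_div_mod h (by rw [hu2, hv2, h])
      refine ⟨h1, ?_⟩
      rw [hu2, hv2]
      exact hmono S _ hu1 _ h1
  · intro F hF
    have hF := mem_initialChains.1 hF
    ext v
    rw [hvert]
    constructor
    · rintro ⟨h1, h2⟩
      obtain ⟨u, hu, huv⟩ := Finset.mem_image.1 h1
      rw [← huv, ← hF.mod_eq_card hu] at h2
      rwa [eq_of_div_mod huv.symm h2]
    · intro hv
      exact ⟨Finset.mem_image_of_mem _ hv, hF.mod_eq_card hv⟩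
  · intro S hS
    ext s
    rw [Finset.mem_image]
    constructor
    · rintro ⟨v, hv, rfl⟩
      exact ((hvert S v).1 hv).1
    · intro hs
      obtain ⟨v, hv, hvs, -⟩ := hex S hS s hs
      exact ⟨v, hv, hvs⟩

/-! ### Collapsing the complex -/

variable {Δ : LowerSet (Finset (Fin n))} {k l : ℕ}

/-- Chains of length 1 are the nonzero multiples of `t`. Without them 0 is the only vertex of
residue 0, and being the least vertex it can join every face. -/
lemma contractibleSpace_deletion_initialChains_one (hl : 1 ≤ l) (hn : n = k * t + l)
    (hΔ : ∀ F, F ∈ Δ ↔ (∀ v ∈ F, v.1 % t < l) ∧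
      ∀ u ∈ F, ∀ v ∈ F, u < v → u.1 % t < v.1 % t) :
    ContractibleSpace (realization (deletion Δ (initialChains n t 1))) := by
  have hn0 : 0 < n := by omega
  let z : Fin n := ⟨0, hn0⟩
  have hz : z.1 % t = 0 := Nat.zero_mod t
  refine contractibleSpace_realization_of_cone z ⟨(hΔ _).2 (by simp), fun τ hτ h => ?_⟩
    fun F hF => ⟨(hΔ _).2 ?_, fun τ hτ h => ?_⟩
  · obtain ⟨v, hv, -⟩ := (mem_initialChains.1 hτ).exists_mod 0 one_pos
    exact Finset.notMem_empty v (h hv)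
  · obtain ⟨hF1, hF2⟩ := (hΔ F).1 hF.1
    have hpos : ∀ v ∈ F, z < v → 0 < v.1 % t := by
      intro v hv hzv
      by_contra h0
      have h0 : v.1 % t = 0 := by omega
      refine hF.2 {v} (mem_initialChains.2 ⟨by simp [h0], fun i hi => ⟨v, by simp, ?_⟩, ?_, ?_⟩)
        (by simpa using hv)
      · omega
      · simp only [Finset.mem_singleton, forall_eq]
        have h1 := Nat.div_add_mod v.1 t
        have h2 : 0 < v.1 := hzv
        rw [h0, add_zero] at h1
        rw [← h1] at h2
        exact Nat.pos_of_mul_pos_left h2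
      · simp
    refine ⟨?_, ?_⟩
    · rw [Finset.forall_mem_insert, hz]
      exact ⟨hl, hF1⟩
    · intro u hu v hv huv
      rcases Finset.mem_insert.1 hu with rfl | hu
      · rcases Finset.mem_insert.1 hv with rfl | hv
        · exact absurd huv (lt_irrefl _)
        · rw [hz]
          exact hpos v hv huv
      · rcases Finset.mem_insert.1 hv with rfl | hv
        · exact absurd huv (Nat.not_lt_zero _)
        · exact hF2 u hu v hv huv
  · refine hF.2 τ hτ fun v hv => (Finset.mem_insert.1 (h hv)).resolve_left ?_
    rintro rfl
    have := (mem_initialChains.1 hτ).div_pos z hv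
    simp [z] at this

/-- Let `m` be the last vertex of a chain `τ` of length `j`. A face through `τ` without chains of
length `j + 1` has no vertex of residue `j` in a block after that of `m`. So `m + 1`, which has
residue `j` in the block of `m`, can join the face. -/
lemma contractibleSpace_deletion_initialChains_succ {j : ℕ} (hj : 1 ≤ j) (hjl : j < l)
    (hn : n = k * t + l) (hlt : l ≤ t)
    (hΔ : ∀ F, F ∈ Δ ↔ (∀ v ∈ F, v.1 % t < l) ∧
      ∀ u ∈ F, ∀ v ∈ F, u < v → u.1 % t < v.1 % t)
    (h : ContractibleSpace (realization (deletion Δ (initialChains n t j)))) :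
    ContractibleSpace (realization (deletion Δ (initialChains n t (j + 1)))) := by
  have ht : 0 < t := by omega
  have hdel : deletion (deletion Δ (initialChains n t (j + 1))) (initialChains n t j) =
      deletion Δ (initialChains n t j) := by
    ext F
    refine ⟨fun hF => ⟨hF.1.1, hF.2⟩, fun hF => ⟨⟨hF.1, fun τ hτ hτF => ?_⟩, hF.2⟩⟩
    exact hF.2 _ (mem_initialChains.2 ((mem_initialChains.1 hτ).filter_mod_lt j.le_succ))
      ((Finset.filter_subset _ _).trans hτF)
  -- The successor of `m` is still a vertex, since `m / t ≤ k` and its residue is `j < l`. Off the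
  -- family, `w` is a dummy value.
  have hw : ∀ τ : Finset (Fin n), ∃ w : Fin n, τ ∈ initialChains n t j →
      ∃ m ∈ τ, m.1 % t + 1 = j ∧ w.1 = m.1 + 1 := by
    intro τ
    by_cases hτ : τ ∈ initialChains n t j
    · obtain ⟨m, hm, hmj⟩ := (mem_initialChains.1 hτ).exists_mod (j - 1) (by omega)
      have h1 : m.1 / t ≤ k := by
        rw [← Nat.lt_succ_iff, Nat.div_lt_iff_lt_mul ht, Nat.succ_mul]
        exact m.2.trans_le (by omega)
      have h2 := Nat.mul_le_mul_left t h1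
      have h3 := Nat.div_add_mod m.1 t
      rw [mul_comm t k] at h2
      exact ⟨⟨m.1 + 1, by omega⟩, fun _ => ⟨m, hm, by omega, rfl⟩⟩
    · exact ⟨⟨0, by omega⟩, fun h => absurd h hτ⟩
  choose w hw using hw
  refine contractibleSpace_realization_of_deletion w (initialChains n t j) ?_ (hdel ▸ h)
  intro τ hτ
  obtain ⟨m, hm, hmj, hwm⟩ := hw τ hτ
  have hτc := mem_initialChains.1 hτ
  have hwt : (w τ).1 = t * (m.1 / t) + j := by
    have := Nat.div_add_mod m.1 t
    omega
  have hwdiv : (w τ).1 / t = m.1 / t := by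
    rw [hwt, Nat.mul_add_div ht, Nat.div_eq_of_lt (hjl.trans_le hlt), add_zero]
  have hwmod : (w τ).1 % t = j := by
    rw [hwt, Nat.mul_add_mod, Nat.mod_eq_of_lt (hjl.trans_le hlt)]
  have hmw : m < w τ := by
    rw [Fin.lt_def]
    omega
  refine ⟨⟨m, hm⟩, fun hwτ => ?_, fun F hF hτF => ?_⟩
  · have := hτc.mod_lt _ hwτ
    omega
  obtain ⟨hF1, hF2⟩ := (hΔ F).1 hF.1
  have hinj := injOn_mod hF2
  have hmF := hτF hm
  have hbelow : ∀ u ∈ F, u < w τ → u.1 % t < j := by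
    intro u hu huw
    rcases lt_trichotomy u m with hum | rfl | hum
    · have := hF2 u hu m hmF hum
      omega
    · omega
    · rw [Fin.lt_def] at huw hum
      omega
  have habove : ∀ u ∈ F, w τ < u → j < u.1 % t := by
    intro u hu hwu
    have hmu := hmw.trans hwu
    have h1 := hF2 m hmF u hu hmu
    by_contra hcon
    have huj : u.1 % t = j := by omega
    -- A vertex `u > w τ` of residue `j` lies in a later block than `m`, so it would extend `τ` to a
    -- forbidden chain.
    have hdiv : m.1 / t < u.1 / t := by
      refine lt_of_le_of_ne (Nat.div_le_div_right hmu.le) fun h => hwu.ne ?_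
      exact eq_of_div_mod (hwdiv.trans h) (hwmod.trans huj.symm)
    have hτu : ∀ v ∈ τ, v.1 / t < u.1 / t ∧ v.1 % t < u.1 % t := by
      intro v hv
      have h2 := hτc.mod_lt v hv
      refine ⟨lt_of_le_of_lt ?_ hdiv, huj ▸ h2⟩
      rcases lt_trichotomy v m with hvm | rfl | hvm
      · exact (hτc.lt v hv m hm hvm).1.le
      · exact le_rfl
      · have := (hτc.lt m hm v hv hvm).2
        omega
    refine hF.2 (insert u τ) (mem_initialChains.2 ⟨?_, ?_, ?_, ?_⟩)
      (Finset.insert_subset hu hτF)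
    · rw [Finset.forall_mem_insert]
      exact ⟨by omega, fun v hv => (hτc.mod_lt v hv).trans (Nat.lt_succ_self j)⟩
    · intro i hi
      rcases Nat.lt_succ_iff_lt_or_eq.1 hi with hi | rfl
      · obtain ⟨v, hv, hvi⟩ := hτc.exists_mod i hi
        exact ⟨v, Finset.mem_insert_of_mem hv, hvi⟩
      · exact ⟨u, Finset.mem_insert_self _ _, huj⟩
    · rw [Finset.forall_mem_insert]
      exact ⟨(Nat.zero_le _).trans_lt hdiv, hτc.div_pos⟩
    · intro x hx y hy hxy
      rcases Finset.mem_insert.1 hx with rfl | hx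
      · rcases Finset.mem_insert.1 hy with rfl | hy
        · exact absurd hxy (lt_irrefl _)
        · exact absurd (hτu y hy).1 (Nat.div_le_div_right hxy.le).not_gt
      · rcases Finset.mem_insert.1 hy with hyu | hy
        · exact hyu ▸ hτu x hx
        · exact hτc.lt x hx y hy hxy
  refine ⟨⟨(hΔ _).2 ⟨?_, ?_⟩, fun ρ hρ hρF => ?_⟩, fun ρ hρ hρF => ?_⟩
  · rw [Finset.forall_mem_insert, hwmod]
    exact ⟨hjl, hF1⟩
  · intro x hx y hy hxy
    rcases Finset.mem_insert.1 hx with rfl | hx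
    · rcases Finset.mem_insert.1 hy with rfl | hy
      · exact absurd hxy (lt_irrefl _)
      · rw [hwmod]
        exact habove y hy hxy
    · rcases Finset.mem_insert.1 hy with rfl | hy
      · rw [hwmod]
        exact hbelow x hx hxy
      · exact hF2 x hx y hy hxy
  -- A new chain of length `j + 1` would contain `w τ` and also `m`, the only vertex of `F` with its
  -- residue; but these two have equal quotients.
  · have hρc := mem_initialChains.1 hρ
    have hwρ : w τ ∈ ρ := by
      by_contra hwρ
      exact hF.2 ρ hρ fun v hv => (Finset.mem_insert.1 (hρF hv)).resolve_left
        fun h => hwρ (h ▸ hv)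
    obtain ⟨u, hu, huj⟩ := hρc.exists_mod (m.1 % t) (by omega)
    have huF : u ∈ F := (Finset.mem_insert.1 (hρF hu)).resolve_left
      fun h => by rw [h] at huj; omega
    have hum : u = m := hinj huF hmF huj
    have := (hρc.lt u hu _ hwρ (hum ▸ hmw)).1
    rw [hum, hwdiv] at this
    exact lt_irrefl _ this
  -- A chain of length `j` cannot use `w τ`, of residue `j`, and `F` has only one vertex per
  -- residue, so the chain is `τ`.
  · have hρc := mem_initialChains.1 hρ
    have hρF' : ρ ⊆ F := fun v hv => (Finset.mem_insert.1 (hρF hv)).resolve_left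
      fun h => by
        have := hρc.mod_lt v hv
        rw [h] at this
        omega
    have hsub : ρ ⊆ τ := by
      intro v hv
      obtain ⟨u, hu, huv⟩ := hτc.exists_mod _ (hρc.mod_lt v hv)
      rwa [← hinj (hτF hu) (hρF' hv) huv]
    exact Finset.eq_of_subset_of_card_le hsub (by rw [hρc.card_eq, hτc.card_eq])

lemma contractibleSpace_deletion_initialChains (hl : 1 ≤ l) (hn : n = k * t + l) (hlt : l ≤ t)
    (hΔ : ∀ F, F ∈ Δ ↔ (∀ v ∈ F, v.1 % t < l) ∧
      ∀ u ∈ F, ∀ v ∈ F, u < v → u.1 % t < v.1 % t) :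
    ContractibleSpace (realization (deletion Δ (initialChains n t l))) := by
  have key : ∀ j, 1 ≤ j → j ≤ l →
      ContractibleSpace (realization (deletion Δ (initialChains n t j))) := by
    intro j hj
    induction j, hj using Nat.le_induction with
    | base => exact fun _ => contractibleSpace_deletion_initialChains_one hl hn hΔ
    | succ j hj ih =>
      exact fun hjl => contractibleSpace_deletion_initialChains_succ hj hjl hn hlt hΔ
        (ih (Nat.le_of_succ_le hjl))
  exact key l hl le_rfl

/-- A chain of length `l` uses every residue below `l`, so it is a facet and deleting it removes no
larger face. -/
lemma mem_and_notMem_deletion_iff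
    (hΔ : ∀ F, F ∈ Δ ↔ (∀ v ∈ F, v.1 % t < l) ∧
      ∀ u ∈ F, ∀ v ∈ F, u < v → u.1 % t < v.1 % t) (F : Finset (Fin n)) :
    F ∈ Δ ∧ F ∉ deletion Δ (initialChains n t l) ↔ F ∈ initialChains n t l := by
  constructor
  · rintro ⟨hF, hF'⟩
    rw [mem_deletion] at hF'
    push Not at hF'
    obtain ⟨τ, hτ, hτF⟩ := hF' hF
    obtain ⟨hF1, hF2⟩ := (hΔ F).1 hF
    have : F = τ := by
      refine Finset.Subset.antisymm (fun v hv => ?_) hτF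
      obtain ⟨u, hu, huv⟩ := (mem_initialChains.1 hτ).exists_mod _ (hF1 v hv)
      rwa [← injOn_mod hF2 (hτF hu) hv huv]
    rwa [this]
  · intro hF
    have hFc := mem_initialChains.1 hF
    exact ⟨(hΔ F).2 ⟨hFc.mod_lt, fun u hu v hv huv => (hFc.lt u hu v hv huv).2⟩,
      fun h => h.2 F hF subset_rfl⟩

end Chains

end

end TYoung

/-! ### The homotopy type of the complex -/

theorem mainTheorem7 (K : Type*) [Field K] (n k t l : ℕ) (ht : 0 < t)
    (hn : n = k * t + l) (hl : 1 ≤ l) (hlt : l ≤ t) :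
    Nonempty (ContinuousMap.HomotopyEquiv
      (TYoung.realization (TYoung.pathDualComplex K n t k))
      (TYoung.WedgeOfSpheres (k.choose l) (l - 1))) ∧
    (k < l → ContractibleSpace (TYoung.realization (TYoung.pathDualComplex K n t k))) := by
  have hΔ : ∀ F, F ∈ TYoung.pathDualComplex K n t k ↔ _ := fun F =>
    TYoung.mem_pathDualComplex_iff ht hn hlt
  have hD := TYoung.contractibleSpace_deletion_initialChains hl hn hlt hΔ
  have hmem := TYoung.mem_and_notMem_deletion_iff hΔ
  refine ⟨TYoung.homotopyEquiv_wedgeOfSpheres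
      (Δ' := TYoung.deletion _ (TYoung.initialChains n t l)) (fun F hF => hF.1) (fun F hF hF' => ?_) ?_,
    fun hkl => ?_⟩
  · rw [(TYoung.mem_initialChains.1 ((hmem F).1 ⟨hF, hF'⟩)).card_eq]
    omega
  · rw [Nat.card_congr (Equiv.subtypeEquivRight hmem), Nat.card_eq_fintype_card,
      Fintype.card_coe, TYoung.card_initialChains ht hn hlt]
  -- For `k < l` there are no chains to delete, so the contractible subcomplex is the whole complex.
  · have hempty : TYoung.initialChains n t l = ∅ := by
      rw [← Finset.card_eq_zero, TYoung.card_initialChains ht hn hlt, Nat.choose_eq_zero_of_lt hkl]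
    rwa [hempty, TYoung.deletion_empty] at hD
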